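/- A hypergraph is a pair $(V,E)$ with $E$ a set of subsets of $V$; a subhypergraph of $(V,E)$ is a hypergraph $(V',E')$ with $V'\subseteq V$ and $E'\subseteq E$. A hypergraph is $3$-uniform if every edge has exactly three vertices, linear if any two distinct edges share at most one vertex, and $2$-regular if it has at least one vertex and every vertex lies in exactly two edges. Let $f(n)$ denote the maximum number of edges of a linear $3$-uniform hypergraph on $n$ vertices that contains no $2$-regular subhypergraph. **Theorem.** There is an absolute constant $C>0$ such that for every integer $n\ge 3$, every linear $3$-uniform hypergraph on $n$ vertices with at least $n\exp\big(C\sqrt{(\log n)(\log\log n)}\big)$ edges contains a $2$-regular subhypergraph, and $$f(n)\le n\exp\big(C\sqrt{(\log n)(\log\log n)}\big).$$ Consequently $f(n)=n^{1+o(1)}$; that is, there is a sequence $\varepsilon_n\to 0$ such that $f(n)=n^{1+\varepsilon_n}$ for all $n\ge 3$. -/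

import Mathlib

open Filter Topology

namespace Hypergraph

variable {α : Type*}

/-- Every edge has exactly `k` vertices. (For `k ≥ 1` this also forces the edges to be finite.) -/
def IsUniform (H : Hypergraph α) (k : ℕ) : Prop :=
  ∀ e ∈ H.edgeSet, e.ncard = k

/-- Any two distinct edges have at most one vertex in common. -/
def IsLinear (H : Hypergraph α) : Prop :=
  ∀ e ∈ H.edgeSet, ∀ f ∈ H.edgeSet, e ≠ f → (e ∩ f).Subsingleton

/-- The number of edges containing the vertex `v`. -/
noncomputable def degree (H : Hypergraph α) (v : α) : ℕ∞ :=
  {e ∈ H.edgeSet | v ∈ e}.encard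

/-- A non-empty hypergraph is `r`-regular if all its vertices have degree `r`. -/
def IsRegular (H : Hypergraph α) (r : ℕ) : Prop :=
  H.vertexSet.Nonempty ∧ ∀ v ∈ H.vertexSet, H.degree v = r

/-- `K` is a (not necessarily induced or spanning) subhypergraph of `H`. -/
def IsSubhypergraph (K H : Hypergraph α) : Prop :=
  K.vertexSet ⊆ H.vertexSet ∧ K.edgeSet ⊆ H.edgeSet

/-- `H` contains an `r`-regular subhypergraph. -/
def ContainsRegular (H : Hypergraph α) (r : ℕ) : Prop :=
  ∃ K : Hypergraph α, K.IsSubhypergraph H ∧ K.IsRegular r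

/-- The possible numbers of edges of a linear `3`-uniform hypergraph on `n` vertices
that has no `2`-regular subhypergraph. -/
def edgeCounts (n : ℕ) : Set ℕ :=
  {m | ∃ H : Hypergraph (Fin n), H.vertexSet = Set.univ ∧ H.IsUniform 3 ∧ H.IsLinear ∧
    ¬ H.ContainsRegular 2 ∧ H.edgeSet.ncard = m}

/-- `f(n)`, the maximum number of edges of a linear `3`-uniform hypergraph on `n` vertices
that has no `2`-regular subhypergraph. -/
noncomputable def maxEdges (n : ℕ) : ℕ := sSup (edgeCounts n)

/-- The supremum in the definition of `maxEdges` is a maximum. -/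
theorem isGreatest_maxEdges (n : ℕ) : IsGreatest (edgeCounts n) (maxEdges n) := by
  have hb : BddAbove (edgeCounts n) := by
    refine ⟨Nat.card (Set (Fin n)), ?_⟩
    rintro m ⟨H, -, -, -, -, rfl⟩
    exact Set.ncard_le_card _
  have hne : (edgeCounts n).Nonempty := by
    refine ⟨0, ⟨Set.univ, ∅, by simp⟩, rfl, by simp [IsUniform], by simp [IsLinear], ?_, by simp⟩
    rintro ⟨K, ⟨-, hE⟩, ⟨v, hv⟩, hr⟩
    have h0 : K.edgeSet = ∅ := Set.subset_empty_iff.mp hE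
    have h2 := hr v hv
    simp [degree, h0] at h2
  exact ⟨Nat.sSup_mem hne hb, fun m hm => le_csSup hb hm⟩

end Hypergraph

/-! Two different matchings covering the same vertices have a 2-regular symmetric difference. So it
suffices that matchings outnumber the vertex sets they can cover. Averaging over 3-colourings
(`exists_tripartition`) and a dyadic pigeonhole on degrees (`exists_almostRegular`) reduce to a
linear tripartite hypergraph whose parts have maximum degrees ΔA ≤ ΔB ≤ ΔC, all at least T and all
within a polylogarithmic factor K of the average degree in their part.

If ΔA ΔB exceeds a constant times K³ ΔC, counting matchings of about |E|/ΔC edges suffices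
(`exists_isTwoRegular_of_balanced`). Otherwise ΔC/ΔB is large. Regard the edges as a bipartite graph
on the first two parts, coloured by the third vertex; linearity makes the colouring proper. Any half
of the edges contains a rainbow cycle of length at most l = 2(k+1), so many such cycles can be
packed greedily, vertex-disjointly in the first two parts and with bounded load on each colour
(`exists_isPacking`). Such cycles already have degree two in the first two parts, so only colours
have to be matched: two different families of colour-disjoint cycles with the same total colour set
finish the proof (`exists_isTwoRegular_of_rainbow`).

Rainbow cycles come from a moment argument (`trace_pow_le_of_no_rainbow`). Without rainbow closed
walks of length 2(k+1), every such walk repeats a colour at two positions, and a rearrangement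
inequality for traces bounds these walks by l² Δ tr A^(2k), with A the adjacency matrix and Δ the
maximum degree in the graph. Then the spectral radius of A² is at most about l² Δ up to a factor
n^(1/(k+1)), contradicting the density of the graph.

The requirements on T are roughly T ≥ (Kl)^l, up to constants in the base and powers of K, and
T^(k+1) > n (K l)^(O(k)). Taking k ≈ √(log n / log log n) balances them at T = exp(O(√(log n log log
n))). -/

set_option linter.unusedSectionVars false

/-! ### Trace inequalities for real symmetric matrices -/

namespace Matrix

variable {W : Type*} [Fintype W] [DecidableEq W]

/-- Orthogonal diagonalization of a real symmetric matrix. -/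
theorem exists_orthogonal_diagonalization {A : Matrix W W ℝ} (hA : A.IsSymm) :
    ∃ (U : Matrix W W ℝ) (ev : W → ℝ), Uᵀ * U = 1 ∧ U * Uᵀ = 1 ∧ A = U * diagonal ev * Uᵀ := by
  have hH : A.IsHermitian := by
    rw [Matrix.IsHermitian, conjTranspose_eq_transpose_of_trivial]; exact hA
  refine ⟨hH.eigenvectorUnitary, hH.eigenvalues, ?_, ?_, ?_⟩
  · have := Unitary.coe_star_mul_self hH.eigenvectorUnitary
    rwa [star_eq_conjTranspose, conjTranspose_eq_transpose_of_trivial] at this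
  · have := Unitary.coe_mul_star_self hH.eigenvectorUnitary
    rwa [Unitary.coe_star, star_eq_conjTranspose, conjTranspose_eq_transpose_of_trivial] at this
  · have := hH.spectral_theorem
    rw [Unitary.conjStarAlgAut_apply, star_eq_conjTranspose,
      conjTranspose_eq_transpose_of_trivial] at this
    exact this

theorem orthogonal_conj_pow {U D : Matrix W W ℝ} (h1 : Uᵀ * U = 1) (h2 : U * Uᵀ = 1) (m : ℕ) :
    (U * D * Uᵀ) ^ m = U * D ^ m * Uᵀ := by
  induction m with
  | zero => simp [h2]
  | succ m ih =>
    rw [pow_succ, ih, pow_succ]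
    calc U * D ^ m * Uᵀ * (U * D * Uᵀ) = U * D ^ m * (Uᵀ * U) * D * Uᵀ := by
          simp only [Matrix.mul_assoc]
      _ = _ := by rw [h1]; simp only [Matrix.mul_assoc, Matrix.one_mul]

/-- For nonnegative u, v the differences u^a − v^a and u^b − v^b have the same sign. Evenness of a +
b lets absolute values be inserted on the right-hand side, which covers negative eigenvalues. -/
theorem pow_mul_pow_add_le {x y : ℝ} {a b : ℕ} (h : Even (a + b)) :
    x ^ a * y ^ b + y ^ a * x ^ b ≤ x ^ (a + b) + y ^ (a + b) := by
  have key : ∀ u v : ℝ, 0 ≤ u → 0 ≤ v →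
      u ^ a * v ^ b + v ^ a * u ^ b ≤ u ^ (a + b) + v ^ (a + b) := by
    intro u v hu hv
    have : 0 ≤ (u ^ a - v ^ a) * (u ^ b - v ^ b) := by
      rcases le_total u v with h | h
      · exact mul_nonneg_of_nonpos_of_nonpos (sub_nonpos.2 (pow_le_pow_left₀ hu h _))
          (sub_nonpos.2 (pow_le_pow_left₀ hu h _))
      · exact mul_nonneg (sub_nonneg.2 (pow_le_pow_left₀ hv h _))
          (sub_nonneg.2 (pow_le_pow_left₀ hv h _))
    rw [pow_add, pow_add]
    nlinarith
  have h1 := key |x| |y| (abs_nonneg _) (abs_nonneg _)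
  rw [h.pow_abs, h.pow_abs] at h1
  refine le_trans (add_le_add ?_ ?_) h1
  · rw [← abs_pow, ← abs_pow, ← abs_mul]; exact le_abs_self _
  · rw [← abs_pow, ← abs_pow, ← abs_mul]; exact le_abs_self _

theorem trace_diagonal_form {Q : Matrix W W ℝ} (hQ : Q.IsSymm) (d e : W → ℝ) :
    (Q * diagonal d * Q * diagonal e).trace = ∑ i, ∑ j, Q i j ^ 2 * (d j * e i) := by
  refine Finset.sum_congr rfl fun i _ => ?_
  rw [diag_apply, mul_diagonal, mul_apply, Finset.sum_mul]
  refine Finset.sum_congr rfl fun j _ => ?_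
  rw [mul_diagonal]
  rw [← hQ.apply i j]
  ring

/-- For symmetric `A`, `P`, moving all powers of `A` together increases the trace. -/
theorem trace_mul_pow_mul_pow_le {A P : Matrix W W ℝ} (hA : A.IsSymm) (hP : P.IsSymm) {a b : ℕ}
    (h : Even (a + b)) : (P * A ^ a * P * A ^ b).trace ≤ (P * P * A ^ (a + b)).trace := by
  obtain ⟨U, ev, h1, h2, rfl⟩ := exists_orthogonal_diagonalization hA
  set Q := Uᵀ * P * U with hQdef
  have hQ : Q.IsSymm := by
    rw [Matrix.IsSymm, hQdef, transpose_mul, transpose_mul, hP.eq, transpose_transpose,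
      Matrix.mul_assoc]
  have conv : ∀ a b : ℕ, (P * (U * diagonal ev * Uᵀ) ^ a * P * (U * diagonal ev * Uᵀ) ^ b).trace
      = ∑ i, ∑ j, Q i j ^ 2 * (ev j ^ a * ev i ^ b) := by
    intro a b
    rw [orthogonal_conj_pow h1 h2, orthogonal_conj_pow h1 h2, diagonal_pow, diagonal_pow]
    have : (P * (U * diagonal (ev ^ a) * Uᵀ) * P * (U * diagonal (ev ^ b) * Uᵀ)).trace
        = (Q * diagonal (ev ^ a) * Q * diagonal (ev ^ b)).trace := by
      rw [hQdef]
      calc _ = ((P * U * diagonal (ev ^ a) * Uᵀ * P * U * diagonal (ev ^ b)) * Uᵀ).trace := by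
            simp only [Matrix.mul_assoc]
        _ = _ := by rw [trace_mul_comm]; simp only [Matrix.mul_assoc]
    rw [this, trace_diagonal_form hQ]
    rfl
  have e0 : P * P = P * (U * diagonal ev * Uᵀ) ^ 0 * P := by simp
  rw [e0, conv, conv]
  -- The inequality fails termwise; it holds after averaging over the exchange of i and j, which the
  -- symmetric weights Q i j ^ 2 allow.
  have sw : ∀ F : W → W → ℝ, (∑ i, ∑ j, Q i j ^ 2 * F i j) = ∑ i, ∑ j, Q i j ^ 2 * F j i := by
    intro F
    rw [Finset.sum_comm]
    refine Finset.sum_congr rfl fun i _ => Finset.sum_congr rfl fun j _ => ?_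
    rw [hQ.apply]
  have s1 := sw fun i j => ev j ^ a * ev i ^ b
  have s2 := sw fun i j => ev j ^ 0 * ev i ^ (a + b)
  have : (∑ i, ∑ j, Q i j ^ 2 * (ev j ^ a * ev i ^ b)) + (∑ i, ∑ j, Q i j ^ 2 * (ev i ^ a * ev j ^ b))
      ≤ (∑ i, ∑ j, Q i j ^ 2 * (ev j ^ 0 * ev i ^ (a + b)))
        + (∑ i, ∑ j, Q i j ^ 2 * (ev i ^ 0 * ev j ^ (a + b))) := by
    simp only [← Finset.sum_add_distrib, ← mul_add]
    refine Finset.sum_le_sum fun i _ => Finset.sum_le_sum fun j _ => ?_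
    refine mul_le_mul_of_nonneg_left ?_ (sq_nonneg _)
    have := pow_mul_pow_add_le (x := ev j) (y := ev i) h
    simp only [pow_zero, one_mul]
    linarith
  linarith

theorem trace_pow_eq_sum {U : Matrix W W ℝ} {ev : W → ℝ} (h1 : Uᵀ * U = 1) (h2 : U * Uᵀ = 1)
    (m : ℕ) : ((U * diagonal ev * Uᵀ) ^ m).trace = ∑ i, ev i ^ m := by
  rw [orthogonal_conj_pow h1 h2, trace_mul_comm, ← Matrix.mul_assoc, h1, Matrix.one_mul,
    diagonal_pow, trace_diagonal]
  rfl

theorem exists_eigenvalue_sq_ge {U : Matrix W W ℝ} {ev : W → ℝ} (h1 : Uᵀ * U = 1)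
    (h2 : U * Uᵀ = 1) {x : W → ℝ} (hx : 0 < x ⬝ᵥ x) :
    ∃ i, ((U * diagonal ev * Uᵀ) *ᵥ x) ⬝ᵥ ((U * diagonal ev * Uᵀ) *ᵥ x) ≤ ev i ^ 2 * (x ⬝ᵥ x) := by
  have : Nonempty W := by
    by_contra hW
    rw [not_nonempty_iff] at hW
    simp [dotProduct] at hx
  obtain ⟨i, -, hi⟩ := Finset.exists_max_image Finset.univ (fun i => ev i ^ 2) Finset.univ_nonempty
  refine ⟨i, ?_⟩
  have iso : ∀ y z : W → ℝ, (U *ᵥ y) ⬝ᵥ (U *ᵥ z) = y ⬝ᵥ z := by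
    intro y z
    rw [← vecMul_transpose, ← dotProduct_mulVec, mulVec_mulVec, h1, one_mulVec]
  have iso' : ∀ y z : W → ℝ, (Uᵀ *ᵥ y) ⬝ᵥ (Uᵀ *ᵥ z) = y ⬝ᵥ z := by
    intro y z
    rw [← vecMul_transpose, ← dotProduct_mulVec, mulVec_mulVec, transpose_transpose, h2,
      one_mulVec]
  rw [← mulVec_mulVec, ← mulVec_mulVec, iso, ← iso' x x]
  simp only [dotProduct, mulVec_diagonal, Finset.mul_sum]
  refine Finset.sum_le_sum fun j _ => ?_
  have := hi j (Finset.mem_univ _)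
  nlinarith [mul_self_nonneg ((Uᵀ *ᵥ x) j)]

/-- If the even moments of a symmetric matrix grow slowly, its spectral radius is small. -/
theorem rayleigh_pow_le_of_trace_le {A : Matrix W W ℝ} (hA : A.IsSymm) {M : ℝ} (hM : 0 ≤ M)
    {k : ℕ} (htr : (A ^ (2 * (k + 1))).trace ≤ M * (A ^ (2 * k)).trace) {x : W → ℝ} {r : ℝ}
    (hr : 0 ≤ r) (hx : 0 < x ⬝ᵥ x) (hrx : r * (x ⬝ᵥ x) ≤ (A *ᵥ x) ⬝ᵥ (A *ᵥ x)) :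
    r ^ (k + 1) ≤ Fintype.card W * (2 * M) ^ (k + 1) := by
  obtain ⟨U, ev, h1, h2, rfl⟩ := exists_orthogonal_diagonalization hA
  obtain ⟨i, hi⟩ := exists_eigenvalue_sq_ge (ev := ev) h1 h2 hx
  have hri : r ≤ ev i ^ 2 := le_of_mul_le_mul_right (hrx.trans hi) hx
  rw [trace_pow_eq_sum h1 h2, trace_pow_eq_sum h1 h2, Finset.mul_sum] at htr
  have hcard : (1 : ℝ) ≤ Fintype.card W := by
    have : 0 < Fintype.card W := Fintype.card_pos_iff.2 ⟨i⟩
    exact_mod_cast this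
  refine (pow_le_pow_left₀ hr hri _).trans ?_
  set t : W → ℝ := fun j => ev j ^ 2 with ht
  have ht0 : ∀ j, 0 ≤ t j := fun j => sq_nonneg _
  -- The summand M ^ (k + 1) compensates the negative terms, those with t j < M, so that the single
  -- term of the eigenvalue i can be isolated.
  have hsum : ∑ j, (t j ^ k * (t j - M) + M ^ (k + 1)) ≤ Fintype.card W * M ^ (k + 1) := by
    rw [Finset.sum_add_distrib, Finset.sum_const, Finset.card_univ, nsmul_eq_mul]
    have : ∑ j, t j ^ k * (t j - M) ≤ 0 := by
      have e : ∑ j, t j ^ k * (t j - M) = ∑ j, ev j ^ (2 * (k + 1)) - ∑ j, M * ev j ^ (2 * k) := by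
        rw [← Finset.sum_sub_distrib]
        refine Finset.sum_congr rfl fun j _ => ?_
        rw [ht, pow_mul, pow_mul]; ring
      rw [e]; linarith
    linarith
  have hterm : ∀ j, 0 ≤ t j ^ k * (t j - M) + M ^ (k + 1) := by
    intro j
    rcases le_total M (t j) with h | h
    · have := mul_nonneg (pow_nonneg (ht0 j) k) (sub_nonneg.2 h)
      positivity
    · have := mul_le_mul (pow_le_pow_left₀ (ht0 j) h k) (sub_le_self M (ht0 j)) (sub_nonneg.2 h)
        (pow_nonneg hM k)
      rw [← pow_succ] at this
      nlinarith
  have hone := (Finset.single_le_sum (fun j _ => hterm j) (Finset.mem_univ i)).trans hsum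
  have hMk : 0 ≤ M ^ (k + 1) := pow_nonneg hM _
  show t i ^ (k + 1) ≤ _
  rcases le_total (t i) (2 * M) with h | h
  · calc t i ^ (k + 1) ≤ (2 * M) ^ (k + 1) := pow_le_pow_left₀ (ht0 i) h _
      _ ≤ _ := le_mul_of_one_le_left (by positivity) hcard
  · have h3 : t i ^ k * (t i / 2) ≤ t i ^ k * (t i - M) :=
      mul_le_mul_of_nonneg_left (by linarith) (pow_nonneg (ht0 i) k)
    have h4 : t i ^ (k + 1) ≤ 2 * (Fintype.card W * M ^ (k + 1)) := by
      rw [pow_succ]; linarith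
    refine h4.trans ?_
    rw [mul_pow, pow_succ 2 k]
    have : (1 : ℝ) ≤ 2 ^ k := one_le_pow₀ (by norm_num)
    have h5 : (0 : ℝ) ≤ Fintype.card W * M ^ (k + 1) := by positivity
    nlinarith

end Matrix

/-! ### Moment method: closed walks with a repeated colour -/

namespace Matrix

/-- Expands a power of the adjacency matrix over edge sequences. The factors may differ, so that
colour constraints can be imposed at chosen positions. -/
theorem prod_ofFn_sum {R ι : Type*} [Semiring R] [Fintype ι] :
    ∀ (m : ℕ) (g : Fin m → ι → R), (List.ofFn fun i => ∑ e, g i e).prod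
      = ∑ f : Fin m → ι, (List.ofFn fun i => g i (f i)).prod
  | 0, g => by simp
  | m + 1, g => by
    rw [List.ofFn_succ, List.prod_cons, prod_ofFn_sum m, Finset.sum_mul_sum,
      ← Equiv.sum_comp (Fin.consEquiv fun _ => ι), Fintype.sum_prod_type]
    refine Finset.sum_congr rfl fun e _ => Finset.sum_congr rfl fun f _ => ?_
    rw [List.ofFn_succ, List.prod_cons]
    simp [Fin.consEquiv]

theorem prod_ofFn_ite_eq {R : Type*} [Monoid R] (A Q : R) {m : ℕ} {i j : Fin m} (hij : i < j) :
    (List.ofFn fun l => if l = i ∨ l = j then Q else A).prod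
      = A ^ (i : ℕ) * Q * A ^ ((j : ℕ) - i - 1) * Q * A ^ (m - 1 - j) := by
  have hij' : (i : ℕ) < j := hij
  have hj := j.2
  have : (List.ofFn fun l => if l = i ∨ l = j then Q else A)
      = List.replicate i A ++ [Q] ++ List.replicate (j - i - 1) A ++ [Q]
        ++ List.replicate (m - 1 - j) A := by
    refine List.ext_getElem (by simp; omega) fun l h1 h2 => ?_
    simp only [List.getElem_ofFn, Fin.ext_iff, List.getElem_append, List.length_append,
      List.length_replicate, List.length_singleton, List.getElem_replicate, List.getElem_singleton]
    split_ifs <;> first | rfl | omega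
  rw [this]
  simp only [List.prod_append, List.prod_replicate, List.prod_singleton]

theorem prod_list_nonneg {W : Type*} [Fintype W] [DecidableEq W] :
    ∀ (l : List (Matrix W W ℝ)), (∀ M ∈ l, ∀ x y, 0 ≤ M x y) → ∀ x y, 0 ≤ l.prod x y
  | [], _, x, y => by
    rw [List.prod_nil, one_apply]; split_ifs <;> norm_num
  | M :: l, h, x, y => by
    rw [List.prod_cons, mul_apply]
    exact Finset.sum_nonneg fun z _ => mul_nonneg (h M (by simp) _ _)
      (prod_list_nonneg l (fun N hN => h N (by simp [hN])) _ _)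

section Walks

variable {ι γ W : Type*} [Fintype ι] [Fintype γ] [DecidableEq γ] [Fintype W] [DecidableEq W]

/-- The closed walks whose `i`-th and `j`-th edges have the same colour are few. -/
theorem sum_trace_same_colour_le (P : ι → Matrix W W ℝ) (hnn : ∀ e x y, 0 ≤ P e x y)
    (hsymm : ∀ e, (P e).IsSymm) (col : ι → γ) {Δ : ℝ}
    (hoff : ∀ c x y, x ≠ y → ((∑ e with col e = c, P e) * (∑ e with col e = c, P e)) x y = 0)
    (hdiag : ∀ x, ∑ c, ((∑ e with col e = c, P e) * (∑ e with col e = c, P e)) x x ≤ Δ)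
    {k : ℕ} {i j : Fin (2 * (k + 1))} (hij : i < j) :
    ∑ f : Fin (2 * (k + 1)) → ι with col (f i) = col (f j), (List.ofFn fun l => P (f l)).prod.trace
      ≤ Δ * ((∑ e, P e) ^ (2 * k)).trace := by
  set A := ∑ e, P e with hA
  set Q : γ → Matrix W W ℝ := fun c => ∑ e with col e = c, P e with hQ
  have hAs : A.IsSymm := by
    rw [IsSymm, hA, transpose_sum]; exact Finset.sum_congr rfl fun e _ => hsymm e
  have hQs : ∀ c, (Q c).IsSymm := fun c => by
    rw [IsSymm, hQ, transpose_sum]; exact Finset.sum_congr rfl fun e _ => hsymm e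
  have hAnn : ∀ x y, 0 ≤ A x y := fun x y => by
    rw [hA, sum_apply]; exact Finset.sum_nonneg fun e _ => hnn e x y
  have hpow : ∀ m x, 0 ≤ (A ^ m) x x := fun m x => by
    rw [← List.prod_replicate]
    exact prod_list_nonneg _ (fun M hM => by rw [List.eq_of_mem_replicate hM]; exact hAnn) _ _
  have split : ∑ f : Fin (2 * (k + 1)) → ι with col (f i) = col (f j),
      (List.ofFn fun l => P (f l)).prod
      = ∑ c, (List.ofFn fun l => if l = i ∨ l = j then Q c else A).prod := by
    have : ∀ c, (List.ofFn fun l => if l = i ∨ l = j then Q c else A).prod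
        = ∑ f : Fin (2 * (k + 1)) → ι, if col (f i) = c ∧ col (f j) = c then
          (List.ofFn fun l => P (f l)).prod else 0 := by
      intro c
      -- Replacing wrongly coloured edges by zero at positions i and j writes both kinds of factor
      -- as sums over all edges.
      have h1 : (fun l => if l = i ∨ l = j then Q c else A)
          = fun l => ∑ e, if (l = i ∨ l = j) ∧ col e ≠ c then 0 else P e := by
        funext l
        by_cases hl : l = i ∨ l = j
        · simp only [hl, if_true, true_and, hQ, Finset.sum_filter]
          refine Finset.sum_congr rfl fun e _ => ?_
          by_cases h : col e = c <;> simp [h]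
        · simp [hl, hA]
      rw [h1, prod_ofFn_sum]
      refine Finset.sum_congr rfl fun f _ => ?_
      by_cases h : col (f i) = c ∧ col (f j) = c
      · rw [if_pos h]
        congr 2
        funext l
        rw [if_neg]
        rintro ⟨rfl | rfl, h'⟩
        · exact h' h.1
        · exact h' h.2
      · rw [if_neg h]
        refine List.prod_eq_zero ?_
        rw [List.mem_ofFn]
        rw [not_and_or] at h
        rcases h with h | h
        · exact ⟨i, by simp [h]⟩
        · exact ⟨j, by simp [h]⟩
    simp only [this]
    rw [Finset.sum_comm, Finset.sum_filter]
    refine Finset.sum_congr rfl fun f _ => ?_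
    by_cases h : col (f i) = col (f j)
    · simp [h]
    · rw [if_neg h, Finset.sum_eq_zero]
      rintro c -
      rw [if_neg]
      rintro ⟨h1, h2⟩
      exact h (h1.trans h2.symm)
  rw [← trace_sum, split, trace_sum]
  have hij' : (i : ℕ) < j := hij
  have hj := j.2
  -- Cyclicity of the trace merges the two outer powers of A. The remaining exponents add up to the
  -- even number 2 * k, so the rearrangement inequality applies.
  have step : ∀ c, (List.ofFn fun l => if l = i ∨ l = j then Q c else A).prod.trace
      ≤ (Q c * Q c * A ^ (2 * k)).trace := by
    intro c
    rw [prod_ofFn_ite_eq _ _ hij]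
    have e : (A ^ (i : ℕ) * Q c * A ^ ((j : ℕ) - i - 1) * Q c * A ^ (2 * (k + 1) - 1 - j)).trace
        = (Q c * A ^ ((j : ℕ) - i - 1) * Q c * A ^ (2 * (k + 1) - 1 - j + i)).trace := by
      rw [pow_add A (2 * (k + 1) - 1 - j) i]
      calc _ = (A ^ (i : ℕ) * (Q c * A ^ ((j : ℕ) - i - 1) * Q c * A ^ (2 * (k + 1) - 1 - j))).trace := by
            simp only [Matrix.mul_assoc]
        _ = _ := by rw [trace_mul_comm]; simp only [Matrix.mul_assoc]
    have hsum : ((j : ℕ) - i - 1) + (2 * (k + 1) - 1 - j + i) = 2 * k := by omega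
    rw [e]
    refine (trace_mul_pow_mul_pow_le hAs (hQs c) (by rw [hsum]; simp)).trans ?_
    rw [hsum]
  refine (Finset.sum_le_sum fun c _ => step c).trans ?_
  -- Squares of colour classes are diagonal, so summing over colours weights each diagonal entry of
  -- A ^ (2 * k) by at most Δ.
  have : ∀ c, (Q c * Q c * A ^ (2 * k)).trace = ∑ x, (Q c * Q c) x x * (A ^ (2 * k)) x x := by
    intro c
    refine Finset.sum_congr rfl fun x _ => ?_
    rw [diag_apply, mul_apply, Finset.sum_eq_single x]
    · intro y _ hy
      rw [hoff c x y (Ne.symm hy), zero_mul]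
    · simp
  simp only [this]
  rw [Finset.sum_comm]
  simp only [trace, diag_apply, Finset.mul_sum, ← Finset.sum_mul]
  exact Finset.sum_le_sum fun x _ => mul_le_mul_of_nonneg_right (hdiag x) (hpow _ _)

/-- Without rainbow closed walks of length `2 * (k + 1)` the even moments grow slowly. -/
theorem trace_pow_le_of_no_rainbow (P : ι → Matrix W W ℝ) (hnn : ∀ e x y, 0 ≤ P e x y)
    (hsymm : ∀ e, (P e).IsSymm) (col : ι → γ) {Δ : ℝ}
    (hoff : ∀ c x y, x ≠ y → ((∑ e with col e = c, P e) * (∑ e with col e = c, P e)) x y = 0)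
    (hdiag : ∀ x, ∑ c, ((∑ e with col e = c, P e) * (∑ e with col e = c, P e)) x x ≤ Δ)
    {k : ℕ} (hno : ∀ f : Fin (2 * (k + 1)) → ι, Function.Injective (fun i => col (f i)) →
      (List.ofFn fun l => P (f l)).prod.trace = 0) (hΔ : 0 ≤ Δ) :
    ((∑ e, P e) ^ (2 * (k + 1))).trace
      ≤ (2 * (k + 1)) ^ 2 * Δ * ((∑ e, P e) ^ (2 * k)).trace := by
  set m := 2 * (k + 1) with hm
  have htnn : ∀ f : Fin m → ι, 0 ≤ (List.ofFn fun l => P (f l)).prod.trace := fun f =>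
    Finset.sum_nonneg fun x _ => prod_list_nonneg _ (fun M hM => by
      rw [List.mem_ofFn] at hM
      obtain ⟨l, rfl⟩ := hM
      exact hnn _) _ _
  have hAnn : 0 ≤ ((∑ e, P e) ^ (2 * k)).trace := by
    refine Finset.sum_nonneg fun x _ => ?_
    rw [← List.prod_replicate]
    refine prod_list_nonneg _ (fun M hM x y => ?_) _ _
    rw [List.eq_of_mem_replicate hM, sum_apply]
    exact Finset.sum_nonneg fun e _ => hnn e x y
  have h1 : ((∑ e, P e) ^ m).trace = ∑ f : Fin m → ι, (List.ofFn fun l => P (f l)).prod.trace := by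
    rw [← trace_sum, ← prod_ofFn_sum m fun _ e => P e, List.ofFn_const, List.prod_replicate]
  -- Union bound over the pairs of positions that may share a colour; bounding their number by m²
  -- gives the factor (2 * (k + 1)) ^ 2.
  have h2 : ∀ f : Fin m → ι, (List.ofFn fun l => P (f l)).prod.trace
      ≤ ∑ p : Fin m × Fin m with p.1 < p.2,
        if col (f p.1) = col (f p.2) then (List.ofFn fun l => P (f l)).prod.trace else 0 := by
    intro f
    by_cases hf : Function.Injective fun i => col (f i)
    · rw [hno f hf]; simp
    · simp only [Function.Injective, not_forall] at hf
      obtain ⟨a, b, hab, hne⟩ := hf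
      obtain ⟨p, hp, hc⟩ : ∃ p : Fin m × Fin m, p.1 < p.2 ∧ col (f p.1) = col (f p.2) := by
        rcases lt_or_gt_of_ne hne with h | h
        · exact ⟨(a, b), h, hab⟩
        · exact ⟨(b, a), h, hab.symm⟩
      refine le_trans (le_of_eq (if_pos hc).symm)
        (Finset.single_le_sum (f := fun p : Fin m × Fin m => if col (f p.1) = col (f p.2) then
          (List.ofFn fun l => P (f l)).prod.trace else 0) (fun q _ => ?_)
          (Finset.mem_filter.2 ⟨Finset.mem_univ p, hp⟩))
      show 0 ≤ ite _ _ _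
      split_ifs
      · exact htnn f
      · exact le_rfl
  rw [h1]
  refine (Finset.sum_le_sum fun f _ => h2 f).trans ?_
  rw [Finset.sum_comm]
  have h3 : ∀ p ∈ ({p : Fin m × Fin m | p.1 < p.2} : Finset _), (∑ f : Fin m → ι,
      if col (f p.1) = col (f p.2) then (List.ofFn fun l => P (f l)).prod.trace else 0)
      ≤ Δ * ((∑ e, P e) ^ (2 * k)).trace := by
    intro p hp
    rw [← Finset.sum_filter]
    exact sum_trace_same_colour_le P hnn hsymm col hoff hdiag (Finset.mem_filter.1 hp).2
  refine (Finset.sum_le_card_nsmul _ _ _ h3).trans ?_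
  rw [nsmul_eq_mul, mul_assoc]
  refine mul_le_mul_of_nonneg_right ?_ (mul_nonneg hΔ hAnn)
  have : (Finset.filter (fun p : Fin m × Fin m => p.1 < p.2) Finset.univ).card ≤ m * m :=
    (Finset.card_le_univ _).trans (by simp)
  have h4 : ((Finset.filter (fun p : Fin m × Fin m => p.1 < p.2) Finset.univ).card : ℝ)
      ≤ ((m * m : ℕ) : ℝ) := by exact_mod_cast this
  refine h4.trans (le_of_eq ?_)
  rw [hm]; push_cast; ring

end Walks

end Matrix

/-! ### From closed walks to rainbow cycles -/

namespace Tripartite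

variable {ι α β γ : Type*}

/-- The edge `e`, seen in the bipartite graph between the first two parts, joins `x` and `y`. -/
def Joins (pA : ι → α) (pB : ι → β) (e : ι) (x y : α ⊕ β) : Prop :=
  (x = Sum.inl (pA e) ∧ y = Sum.inr (pB e)) ∨ (x = Sum.inr (pB e) ∧ y = Sum.inl (pA e))

theorem Joins.symm {pA : ι → α} {pB : ι → β} {e : ι} {x y : α ⊕ β} (h : Joins pA pB e x y) :
    Joins pA pB e y x := by
  rcases h with h | h
  · exact Or.inr ⟨h.2, h.1⟩
  · exact Or.inl ⟨h.2, h.1⟩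

/-- `S` has degrees zero or two in the first two parts, and at most one in the third part. -/
structure IsRainbow [DecidableEq α] [DecidableEq β] (pA : ι → α) (pB : ι → β) (pC : ι → γ)
    (S : Finset ι) : Prop where
  nonempty : S.Nonempty
  injOn : Set.InjOn pC S
  degA : ∀ e ∈ S, (S.filter fun f => pA f = pA e).card = 2
  degB : ∀ e ∈ S, (S.filter fun f => pB f = pB e).card = 2

/-- The adjacency matrix of a single edge. -/
noncomputable def edgeMatrix (pA : ι → α) (pB : ι → β) (e : ι) : Matrix (α ⊕ β) (α ⊕ β) ℝ :=
  open Classical in Matrix.of fun x y => if Joins pA pB e x y then 1 else 0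

theorem edgeMatrix_nonneg (pA : ι → α) (pB : ι → β) (e : ι) (x y : α ⊕ β) :
    0 ≤ edgeMatrix pA pB e x y := by
  rw [edgeMatrix, Matrix.of_apply]; split_ifs <;> norm_num

theorem joins_of_edgeMatrix_ne_zero {pA : ι → α} {pB : ι → β} {e : ι} {x y : α ⊕ β}
    (h : edgeMatrix pA pB e x y ≠ 0) : Joins pA pB e x y := by
  rw [edgeMatrix, Matrix.of_apply] at h
  by_contra h'
  exact h (if_neg h')

theorem edgeMatrix_isSymm (pA : ι → α) (pB : ι → β) (e : ι) : (edgeMatrix pA pB e).IsSymm := by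
  ext x y
  rw [Matrix.transpose_apply, edgeMatrix, Matrix.of_apply, Matrix.of_apply]
  by_cases h : Joins pA pB e x y
  · rw [if_pos h, if_pos h.symm]
  · rw [if_neg h, if_neg fun h' => h h'.symm]

variable [DecidableEq α] [DecidableEq β] [DecidableEq ι]

/-- A vertex of a simple closed walk is met exactly by the step leaving it and the step entering it,
and distinct colours make these distinct edges. The predicate p abstracts incidence, so one argument
serves both sides of the bipartition. -/
theorem card_incident_eq_two {pA : ι → α} {pB : ι → β} {pC : ι → γ} {z : ℕ → α ⊕ β} {f : ℕ → ι}
    {L : ℕ} (hadj : ∀ i < L, Joins pA pB (f i) (z i) (z (i + 1))) (hz : z L = z 0)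
    (hcol : ∀ i < L, ∀ j < L, pC (f i) = pC (f j) → i = j)
    (hinj : ∀ i < L, ∀ j < L, z i = z j → i = j) {i : ℕ} (hi : i < L) (p : ι → Prop)
    [DecidablePred p] (hp : ∀ j < L, p (f j) ↔ (z j = z i ∨ z (j + 1) = z i)) :
    (((Finset.range L).image f).filter p).card = 2 := by
  -- A bipartite graph has no loops; hence the cyclic predecessor of an index differs from it.
  have hL : L ≠ 1 := by
    rintro rfl
    have := hadj 0 one_pos
    rw [zero_add, hz] at this
    rcases this with ⟨h1, h2⟩ | ⟨h1, h2⟩ <;> rw [h1] at h2 <;> cases h2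
  obtain ⟨j, hj, hji, hprev⟩ : ∃ j < L, j ≠ i ∧ ∀ l < L, z (l + 1) = z i ↔ l = j := by
    rcases Nat.eq_zero_or_pos i with rfl | hpos
    · refine ⟨L - 1, by omega, by omega, fun l hl => ⟨fun h => ?_, fun h => ?_⟩⟩
      · by_contra hne
        have := hinj (l + 1) (by omega) 0 (by omega) h
        omega
      · rw [h, Nat.sub_add_cancel (by omega), hz]
    · refine ⟨i - 1, by omega, by omega, fun l hl => ⟨fun h => ?_, fun h => ?_⟩⟩
      · by_cases hlL : l + 1 = L
        · rw [hlL, hz] at h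
          have := hinj 0 (by omega) i hi h
          omega
        · have := hinj (l + 1) (by omega) i hi h
          omega
      · rw [h, Nat.sub_add_cancel hpos]
  have : ((Finset.range L).image f).filter p = {f i, f j} := by
    ext e
    simp only [Finset.mem_filter, Finset.mem_image, Finset.mem_range, Finset.mem_insert,
      Finset.mem_singleton]
    constructor
    · rintro ⟨⟨l, hl, rfl⟩, h⟩
      rcases (hp l hl).1 h with h | h
      · left; rw [hinj l hl i hi h]
      · right; rw [(hprev l hl).1 h]
    · rintro (rfl | rfl)
      · exact ⟨⟨i, hi, rfl⟩, (hp i hi).2 (Or.inl rfl)⟩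
      · exact ⟨⟨j, hj, rfl⟩, (hp j hj).2 (Or.inr ((hprev j hj).2 rfl))⟩
  rw [this, Finset.card_pair]
  intro h
  exact hji (hcol i hi j hj (by rw [h])).symm

/-- A closed walk with pairwise different colours contains a rainbow cycle. -/
theorem exists_isRainbow_of_closed_walk {pA : ι → α} {pB : ι → β} {pC : ι → γ} (L : ℕ) :
    ∀ (z : ℕ → α ⊕ β) (f : ℕ → ι), 0 < L →
      (∀ i < L, Joins pA pB (f i) (z i) (z (i + 1))) → z L = z 0 →
      (∀ i < L, ∀ j < L, pC (f i) = pC (f j) → i = j) →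
      ∃ S : Finset ι, IsRainbow pA pB pC S ∧ S.card ≤ L := by
  induction L using Nat.strong_induction_on with
  | _ L ih =>
    intro z f hL hadj hz hcol
    by_cases hinj : ∀ i < L, ∀ j < L, z i = z j → i = j
    · have key : ∀ i < L, ∀ (p : ι → Prop) [DecidablePred p],
          (∀ j < L, p (f j) ↔ (z j = z i ∨ z (j + 1) = z i)) →
          (((Finset.range L).image f).filter p).card = 2 :=
        fun i hi p _ hp => card_incident_eq_two hadj hz hcol hinj hi p hp
      have hvert : ∀ j < L, ∀ v, (v = z j ∨ v = z (j + 1)) → ∃ i < L, z i = v := by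
        rintro j hj v (rfl | rfl)
        · exact ⟨j, hj, rfl⟩
        · by_cases h : j + 1 = L
          · exact ⟨0, hL, by rw [h, hz]⟩
          · exact ⟨j + 1, by omega, rfl⟩
      refine ⟨(Finset.range L).image f, ⟨⟨f 0, ?_⟩, ?_, ?_, ?_⟩, ?_⟩
      · exact Finset.mem_image_of_mem f (Finset.mem_range.2 hL)
      · intro e he e' he' h
        simp only [Finset.coe_image, Finset.coe_range, Set.mem_image, Set.mem_Iio] at he he'
        obtain ⟨i, hi, rfl⟩ := he
        obtain ⟨j, hj, rfl⟩ := he'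
        rw [hcol i hi j hj h]
      · intro e he
        obtain ⟨j, hj, rfl⟩ := Finset.mem_image.1 he
        rw [Finset.mem_range] at hj
        obtain ⟨i, hi, hiv⟩ := hvert j hj (Sum.inl (pA (f j))) (by
          rcases hadj j hj with h | h
          · exact Or.inl h.1.symm
          · exact Or.inr h.2.symm)
        refine key i hi _ fun l hl => ?_
        rw [hiv]
        rcases hadj l hl with ⟨h1, h2⟩ | ⟨h1, h2⟩ <;> rw [h1, h2] <;> simp
      · intro e he
        obtain ⟨j, hj, rfl⟩ := Finset.mem_image.1 he
        rw [Finset.mem_range] at hj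
        obtain ⟨i, hi, hiv⟩ := hvert j hj (Sum.inr (pB (f j))) (by
          rcases hadj j hj with h | h
          · exact Or.inr h.2.symm
          · exact Or.inl h.1.symm)
        refine key i hi _ fun l hl => ?_
        rw [hiv]
        rcases hadj l hl with ⟨h1, h2⟩ | ⟨h1, h2⟩ <;> rw [h1, h2] <;> simp
      · exact Finset.card_image_le.trans (by simp)
    · push Not at hinj
      obtain ⟨i, hi, j, hj, hij, hne⟩ := hinj
      obtain ⟨i, j, hlt, hj, hij⟩ : ∃ i j, i < j ∧ j < L ∧ z i = z j := by
        rcases lt_or_gt_of_ne hne with h | h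
        · exact ⟨i, j, h, hj, hij⟩
        · exact ⟨j, i, h, hi, hij.symm⟩
      -- The segment between two visits to the same vertex is a shorter closed walk with distinct
      -- colours.
      obtain ⟨S, hS, hc⟩ := ih (j - i) (by omega) (fun l => z (i + l)) (fun l => f (i + l))
        (by omega) (fun l hl => hadj (i + l) (by omega))
        (by simp only [add_zero]; rw [hij]; congr 1; omega)
        (fun a ha b hb h => by
          have := hcol (i + a) (by omega) (i + b) (by omega) h
          omega)
      exact ⟨S, hS, by omega⟩

variable [Fintype α] [Fintype β]

theorem exists_walk_of_prod_ne_zero (pA : ι → α) (pB : ι → β) :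
    ∀ (l : List ι) (x y : α ⊕ β), (l.map (edgeMatrix pA pB)).prod x y ≠ 0 →
      ∃ z : ℕ → α ⊕ β, z 0 = x ∧ z l.length = y ∧
        ∀ i (hi : i < l.length), Joins pA pB l[i] (z i) (z (i + 1))
  | [], x, y, h => by
    have : x = y := by
      by_contra hne
      exact h (by simp [hne])
    exact ⟨fun _ => x, rfl, this, fun i hi => by simp at hi⟩
  | e :: l, x, y, h => by
    rw [List.map_cons, List.prod_cons, Matrix.mul_apply] at h
    obtain ⟨w, -, hw⟩ := Finset.exists_ne_zero_of_sum_ne_zero h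
    obtain ⟨z, h0, h1, hz⟩ := exists_walk_of_prod_ne_zero pA pB l w y (right_ne_zero_of_mul hw)
    refine ⟨fun i => if i = 0 then x else z (i - 1), by simp, by simpa using h1, ?_⟩
    rintro (_ | i) hi
    · simpa [h0] using joins_of_edgeMatrix_ne_zero (left_ne_zero_of_mul hw)
    · simpa using hz i (by simpa using hi)

theorem exists_isRainbow_of_trace_ne_zero {pA : ι → α} {pB : ι → β} {pC : ι → γ} {m : ℕ}
    (hm : 0 < m) (f : Fin m → ι) (hf : Function.Injective fun i => pC (f i))
    (htr : (List.ofFn fun l => edgeMatrix pA pB (f l)).prod.trace ≠ 0) :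
    ∃ S : Finset ι, IsRainbow pA pB pC S ∧ S.card ≤ m := by
  obtain ⟨x, -, hx⟩ := Finset.exists_ne_zero_of_sum_ne_zero htr
  have e : (List.ofFn fun l => edgeMatrix pA pB (f l)) = (List.ofFn f).map (edgeMatrix pA pB) := by
    rw [List.map_ofFn]; rfl
  rw [e, Matrix.diag_apply] at hx
  obtain ⟨z, h0, h1, hz⟩ := exists_walk_of_prod_ne_zero pA pB _ _ _ hx
  rw [List.length_ofFn] at h1
  -- The value outside the range is a dummy: only indices below m are inspected.
  refine exists_isRainbow_of_closed_walk m z (fun i => if h : i < m then f ⟨i, h⟩ else f ⟨0, hm⟩)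
    hm (fun i hi => ?_) (h1.trans h0.symm) fun i hi j hj h => ?_
  · have := hz i (by simpa using hi)
    simpa [hi] using this
  · simp only [hi, hj, dif_pos] at h
    simpa using hf h

end Tripartite

/-! ### Short rainbow cycles in dense linear tripartite hypergraphs -/

namespace Tripartite

variable {ι α β γ : Type*} [DecidableEq α] [DecidableEq β] [DecidableEq γ]

/-- Any two coordinates of an edge determine it. -/
structure IsLinearOn (pA : ι → α) (pB : ι → β) (pC : ι → γ) (E : Finset ι) : Prop where
  ab : ∀ e ∈ E, ∀ f ∈ E, pA e = pA f → pB e = pB f → e = f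
  bc : ∀ e ∈ E, ∀ f ∈ E, pB e = pB f → pC e = pC f → e = f
  ac : ∀ e ∈ E, ∀ f ∈ E, pA e = pA f → pC e = pC f → e = f

theorem IsLinearOn.mono {pA : ι → α} {pB : ι → β} {pC : ι → γ} {E F : Finset ι}
    (h : IsLinearOn pA pB pC E) (hF : F ⊆ E) : IsLinearOn pA pB pC F :=
  ⟨fun e he f hf => h.ab e (hF he) f (hF hf), fun e he f hf => h.bc e (hF he) f (hF hf),
    fun e he f hf => h.ac e (hF he) f (hF hf)⟩

section Matrices

variable [Fintype α] [Fintype β] [Fintype ι]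

open Matrix in
-- By linearity, edges of one colour form a matching in the bipartite graph. A walk of two steps in
-- one colour therefore returns along the same edge, and the diagonal is bounded by the degree
-- within the colour.
theorem colourClass_mul_self_le {pA : ι → α} {pB : ι → β} {pC : ι → γ}
    (hlin : IsLinearOn pA pB pC Finset.univ) (c : γ) :
    (∀ x y, x ≠ y → ((∑ e with pC e = c, edgeMatrix pA pB e)
      * (∑ e with pC e = c, edgeMatrix pA pB e)) x y = 0) ∧
    ∀ x, ((∑ e with pC e = c, edgeMatrix pA pB e) * (∑ e with pC e = c, edgeMatrix pA pB e)) x x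
      ≤ ∑ e with pC e = c, ∑ z, edgeMatrix pA pB e x z := by
  have uniq : ∀ e e' x y z, pC e = c → pC e' = c → Joins pA pB e x z → Joins pA pB e' z y →
      e' = e := by
    intro e e' x y z he he' h h'
    have hc : pC e' = pC e := he'.trans he.symm
    rcases h with ⟨-, h⟩ | ⟨-, h⟩ <;> rcases h' with ⟨h', -⟩ | ⟨h', -⟩ <;> rw [h] at h'
    · cases h'
    · exact hlin.bc _ (Finset.mem_univ _) _ (Finset.mem_univ _) (Sum.inr_injective h').symm hc
    · exact hlin.ac _ (Finset.mem_univ _) _ (Finset.mem_univ _) (Sum.inl_injective h').symm hc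
    · cases h'
  have expand : ∀ x y, ((∑ e with pC e = c, edgeMatrix pA pB e)
      * (∑ e with pC e = c, edgeMatrix pA pB e)) x y
      = ∑ e with pC e = c, ∑ z, ∑ e' with pC e' = c,
        edgeMatrix pA pB e x z * edgeMatrix pA pB e' z y := by
    intro x y
    rw [mul_apply, Finset.sum_comm]
    refine Finset.sum_congr rfl fun z _ => ?_
    rw [Matrix.sum_apply, Matrix.sum_apply, Finset.sum_mul_sum]
  constructor
  · intro x y hxy
    rw [expand]
    refine Finset.sum_eq_zero fun e he => Finset.sum_eq_zero fun z _ => Finset.sum_eq_zero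
      fun e' he' => ?_
    by_contra hne
    have h := joins_of_edgeMatrix_ne_zero (left_ne_zero_of_mul hne)
    have h' := joins_of_edgeMatrix_ne_zero (right_ne_zero_of_mul hne)
    obtain rfl := uniq e e' x y z (Finset.mem_filter.1 he).2 (Finset.mem_filter.1 he').2 h h'
    rcases h with ⟨h1, h2⟩ | ⟨h1, h2⟩ <;> rcases h' with ⟨h3, h4⟩ | ⟨h3, h4⟩
    · rw [h2] at h3; cases h3
    · exact hxy (h1.trans h4.symm)
    · exact hxy (h1.trans h4.symm)
    · rw [h2] at h3; cases h3
  · intro x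
    rw [expand]
    refine Finset.sum_le_sum fun e he => Finset.sum_le_sum fun z _ => ?_
    by_cases h0 : edgeMatrix pA pB e x z = 0
    · simp [h0]
    have h := joins_of_edgeMatrix_ne_zero h0
    rw [Finset.sum_eq_single e]
    · refine mul_le_of_le_one_right (edgeMatrix_nonneg _ _ _ _ _) ?_
      rw [edgeMatrix, of_apply]; split_ifs <;> norm_num
    · intro e' he' hne
      by_contra hne'
      exact hne (uniq e e' x x z (Finset.mem_filter.1 he).2 (Finset.mem_filter.1 he').2 h
        (joins_of_edgeMatrix_ne_zero (right_ne_zero_of_mul hne')))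
    · exact fun hn => absurd he hn

theorem sum_edgeMatrix_inl (pA : ι → α) (pB : ι → β) (e : ι) (a : α) (x : α ⊕ β → ℝ) :
    ∑ z, edgeMatrix pA pB e (Sum.inl a) z * x z = if pA e = a then x (Sum.inr (pB e)) else 0 := by
  rw [Finset.sum_eq_single (Sum.inr (pB e))]
  · simp only [edgeMatrix, Joins, Matrix.of_apply, Sum.inl.injEq, reduceCtorEq, and_true, and_false,
      or_false, ite_mul, one_mul, zero_mul, eq_comm]
  · intro z _ hz
    have : ¬ Joins pA pB e (Sum.inl a) z := by
      rintro (h | h)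
      · exact hz h.2
      · cases h.1
    simp [edgeMatrix, this]
  · simp

theorem sum_edgeMatrix_inr (pA : ι → α) (pB : ι → β) (e : ι) (b : β) (x : α ⊕ β → ℝ) :
    ∑ z, edgeMatrix pA pB e (Sum.inr b) z * x z = if pB e = b then x (Sum.inl (pA e)) else 0 := by
  rw [Finset.sum_eq_single (Sum.inl (pA e))]
  · simp only [edgeMatrix, Joins, Matrix.of_apply, Sum.inr.injEq, reduceCtorEq, and_true, false_and,
      false_or, ite_mul, one_mul, zero_mul, eq_comm]
  · intro z _ hz
    have : ¬ Joins pA pB e (Sum.inr b) z := by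
      rintro (h | h)
      · cases h.1
      · exact hz h.2
    simp [edgeMatrix, this]
  · simp

open Matrix in
/-- A properly coloured bipartite graph which is not too sparse has a short rainbow cycle. -/
theorem exists_isRainbow_univ [DecidableEq ι] [Fintype γ] [Nonempty ι] {pA : ι → α} {pB : ι → β}
    {pC : ι → γ} (hlin : IsLinearOn pA pB pC Finset.univ) {Δ : ℕ}
    (hA : ∀ a, (Finset.univ.filter fun e => pA e = a).card ≤ Δ)
    (hB : ∀ b, (Finset.univ.filter fun e => pB e = b).card ≤ Δ) {k : ℕ}
    (hbig : ((Fintype.card α + Fintype.card β : ℕ) : ℝ) * (2 * ((2 * (k + 1)) ^ 2 * Δ)) ^ (k + 1)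
      < ((Fintype.card ι : ℝ) ^ 2
        / ((Finset.univ.image pA).card * (Finset.univ.image pB).card)) ^ (k + 1)) :
    ∃ S : Finset ι, IsRainbow pA pB pC S ∧ S.card ≤ 2 * (k + 1) := by
  by_contra hno
  have htr := trace_pow_le_of_no_rainbow (edgeMatrix pA pB) (edgeMatrix_nonneg pA pB)
    (edgeMatrix_isSymm pA pB) pC (Δ := Δ) (k := k)
    (fun c x y hxy => (colourClass_mul_self_le hlin c).1 x y hxy) (fun x => ?_) (fun f hf => ?_)
    (Nat.cast_nonneg _)
  rotate_left
  · refine (Finset.sum_le_sum fun c _ => (colourClass_mul_self_le hlin c).2 x).trans ?_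
    rw [Finset.sum_fiberwise Finset.univ pC fun e => ∑ z, edgeMatrix pA pB e x z]
    rcases x with a | b
    · have : ∀ e, ∑ z, edgeMatrix pA pB e (Sum.inl a) z = if pA e = a then 1 else 0 := fun e => by
        simpa using sum_edgeMatrix_inl pA pB e a fun _ => 1
      simp only [this, Finset.sum_boole]
      exact_mod_cast hA a
    · have : ∀ e, ∑ z, edgeMatrix pA pB e (Sum.inr b) z = if pB e = b then 1 else 0 := fun e => by
        simpa using sum_edgeMatrix_inr pA pB e b fun _ => 1
      simp only [this, Finset.sum_boole]
      exact_mod_cast hB b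
  · by_contra hne
    exact hno (exists_isRainbow_of_trace_ne_zero (by omega) f hf hne)
  -- Rayleigh test vector: the indicator of the occurring vertices of the second part. The adjacency
  -- matrix sends it to the degrees on the first part.
  set x : α ⊕ β → ℝ := Sum.elim (fun _ => 0) fun b => if b ∈ Finset.univ.image pB then 1 else 0
    with hx
  have hxx : x ⬝ᵥ x = (Finset.univ.image pB).card := by
    have : ∀ b, x (Sum.inr b) * x (Sum.inr b) = if b ∈ Finset.univ.image pB then 1 else 0 := by
      intro b
      rw [hx]
      simp only [Sum.elim_inr]
      split_ifs <;> norm_num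
    rw [dotProduct, Fintype.sum_sum_type]
    simp only [this, Finset.sum_boole, Finset.filter_univ_mem]
    simp [hx]
  have hbpos : 0 < (Finset.univ.image pB).card := Finset.card_pos.2 (Finset.univ_nonempty.image _)
  have hapos : 0 < (Finset.univ.image pA).card := Finset.card_pos.2 (Finset.univ_nonempty.image _)
  have hAx : ∀ a, ((∑ e, edgeMatrix pA pB e) *ᵥ x) (Sum.inl a)
      = (Finset.univ.filter fun e => pA e = a).card := by
    intro a
    rw [sum_mulVec, Finset.sum_apply]
    simp only [mulVec, dotProduct, sum_edgeMatrix_inl]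
    simp [hx, Finset.sum_boole]
  -- Cauchy–Schwarz for the degrees in the first part, whose sum is the number of edges.
  have hsq : (Fintype.card ι : ℝ) ^ 2 ≤ (Finset.univ.image pA).card
      * (((∑ e, edgeMatrix pA pB e) *ᵥ x) ⬝ᵥ ((∑ e, edgeMatrix pA pB e) *ᵥ x)) := by
    have h1 : (Fintype.card ι : ℝ)
        = ∑ a ∈ Finset.univ.image pA, ((Finset.univ.filter fun e => pA e = a).card : ℝ) := by
      rw [← Finset.card_univ, Finset.card_eq_sum_card_image pA]
      push_cast
      rfl
    rw [h1]
    refine sq_sum_le_card_mul_sum_sq.trans (mul_le_mul_of_nonneg_left ?_ (Nat.cast_nonneg _))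
    rw [dotProduct, Fintype.sum_sum_type]
    simp only [hAx]
    refine le_trans ?_ (le_add_of_nonneg_right (Finset.sum_nonneg fun b _ => mul_self_nonneg _))
    simp only [← sq]
    exact Finset.sum_le_sum_of_subset_of_nonneg (Finset.subset_univ _) fun _ _ _ => sq_nonneg _
  have := rayleigh_pow_le_of_trace_le (A := ∑ e, edgeMatrix pA pB e) (M := (2 * (k + 1)) ^ 2 * Δ)
    (by rw [IsSymm, transpose_sum]; exact Finset.sum_congr rfl fun e _ => edgeMatrix_isSymm pA pB e)
    (by positivity) htr (x := x) (r := (Fintype.card ι : ℝ) ^ 2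
        / ((Finset.univ.image pA).card * (Finset.univ.image pB).card)) (by positivity)
    (by rw [hxx]; exact_mod_cast hbpos) (by
      rw [hxx]
      have ha : (0 : ℝ) < (Finset.univ.image pA).card := by exact_mod_cast hapos
      have hb : (0 : ℝ) < (Finset.univ.image pB).card := by exact_mod_cast hbpos
      rw [← div_div, div_mul_cancel₀ _ hb.ne', div_le_iff₀' ha]
      exact hsq)
  rw [Fintype.card_sum] at this
  exact absurd hbig (not_lt.2 this)

end Matrices

/-- The relative version, obtained by passing to the subtype of E; the greedy packing needs it for
the edges that survive deletions. -/
theorem exists_isRainbow [DecidableEq ι] [Fintype α] [Fintype β] [Fintype γ] {pA : ι → α}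
    {pB : ι → β} {pC : ι → γ} {E : Finset ι} (hE : E.Nonempty) (hlin : IsLinearOn pA pB pC E)
    {Δ : ℕ} (hA : ∀ a, (E.filter fun e => pA e = a).card ≤ Δ)
    (hB : ∀ b, (E.filter fun e => pB e = b).card ≤ Δ) {k : ℕ}
    (hbig : ((Fintype.card α + Fintype.card β : ℕ) : ℝ) * (2 * ((2 * (k + 1)) ^ 2 * Δ)) ^ (k + 1)
      < ((E.card : ℝ) ^ 2 / ((E.image pA).card * (E.image pB).card)) ^ (k + 1)) :
    ∃ S ⊆ E, IsRainbow pA pB pC S ∧ S.card ≤ 2 * (k + 1) := by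
  have : Nonempty E := hE.to_subtype
  have hiA : (Finset.univ.image fun e : E => pA e) = E.image pA := by
    ext d
    simp
  have hiB : (Finset.univ.image fun e : E => pB e) = E.image pB := by
    ext d
    simp
  have hfil : ∀ (p : ι → Prop) [DecidablePred p] ,
      (Finset.univ.filter fun e : E => p e).card = (E.filter p).card := by
    intro p _
    rw [← Finset.card_map (Function.Embedding.subtype (· ∈ E))]
    congr 1
    ext e
    simp [and_comm]
  have hfil' : ∀ (S : Finset E) (p : ι → Prop) [DecidablePred p] ,
      ((S.map (Function.Embedding.subtype (· ∈ E))).filter p).card = (S.filter fun e : E => p e).card := by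
    intro S p _
    rw [Finset.filter_map, Finset.card_map]
    rfl
  obtain ⟨S, hS, hcard⟩ := exists_isRainbow_univ (ι := E) (pA := fun e => pA e)
    (pB := fun e => pB e) (pC := fun e => pC e) (Δ := Δ) (k := k)
    ⟨fun e _ f _ h h' => Subtype.ext (hlin.ab e e.2 f f.2 h h'),
      fun e _ f _ h h' => Subtype.ext (hlin.bc e e.2 f f.2 h h'),
      fun e _ f _ h h' => Subtype.ext (hlin.ac e e.2 f f.2 h h')⟩
    (fun a => by rw [hfil fun e => pA e = a]; exact hA a)
    (fun b => by rw [hfil fun e => pB e = b]; exact hB b)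
    (by rw [hiA, hiB, Fintype.card_coe]; exact hbig)
  refine ⟨S.map (Function.Embedding.subtype (· ∈ E)), ?_, ⟨?_, ?_, ?_, ?_⟩, ?_⟩
  · intro e he
    obtain ⟨f, -, rfl⟩ := Finset.mem_map.1 he
    exact f.2
  · exact hS.nonempty.map
  · intro e he f hf h
    obtain ⟨e, he', rfl⟩ := Finset.mem_map.1 (Finset.mem_coe.1 he)
    obtain ⟨f, hf', rfl⟩ := Finset.mem_map.1 (Finset.mem_coe.1 hf)
    rw [hS.injOn he' hf' h]
  · intro e he
    obtain ⟨e, he', rfl⟩ := Finset.mem_map.1 he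
    rw [hfil' S fun f => pA f = _]
    exact hS.degA e he'
  · intro e he
    obtain ⟨e, he', rfl⟩ := Finset.mem_map.1 he
    rw [hfil' S fun f => pB f = _]
    exact hS.degB e he'
  · rwa [Finset.card_map]

end Tripartite

/-! ### Counting matchings, and the balanced case -/

namespace Tripartite

section Counting

variable {τ δ : Type*} [DecidableEq τ]

/-- The `m`-element subsets of `G` whose elements are pairwise compatible. -/
noncomputable def matchings (G : Finset τ) (r : τ → τ → Prop) (m : ℕ) : Finset (Finset τ) :=
  @Finset.filter _ (fun M => (M : Set τ).Pairwise r) (Classical.decPred _) (G.powersetCard m)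

theorem mem_matchings {G : Finset τ} {r : τ → τ → Prop} {m : ℕ} {M : Finset τ} :
    M ∈ matchings G r m ↔ (M ⊆ G ∧ M.card = m) ∧ (M : Set τ).Pairwise r := by
  let := Classical.decPred fun M : Finset τ => (M : Set τ).Pairwise r
  rw [matchings, Finset.mem_filter, Finset.mem_powersetCard]

/-- Double counting of inclusions M ⊆ M': a j-matching excludes at most j * D elements and can be
extended by any other, while a (j + 1)-matching has only j + 1 subsets of size j. -/
theorem card_matchings_mul_le {G : Finset τ} {r : τ → τ → Prop} [DecidableRel r] (hsymm : ∀ g h, r g h → r h g)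
    (hirr : ∀ g ∈ G, ¬ r g g) {D : ℕ} (hD : ∀ h ∈ G, (G.filter fun g => ¬ r h g).card ≤ D) (j : ℕ) :
    (matchings G r j).card * (G.card - j * D) ≤ (matchings G r (j + 1)).card * (j + 1) := by
  refine Finset.card_mul_le_card_mul (fun M M' : Finset τ => M ⊆ M') (fun M hM => ?_)
    (fun M' hM' => ?_)
  · obtain ⟨⟨hMG, hMc⟩, hMr⟩ := mem_matchings.1 hM
    set bad := M.biUnion fun h => G.filter fun g => ¬ r h g with hbad
    have hbadc : bad.card ≤ j * D := by
      refine (Finset.card_biUnion_le_card_mul _ _ D fun h hh => hD h (hMG hh)).trans ?_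
      rw [hMc]
    have hnot : ∀ g ∈ G \ bad, g ∉ M ∧ ∀ h ∈ M, r h g := by
      intro g hg
      obtain ⟨hgG, hgb⟩ := Finset.mem_sdiff.1 hg
      have hcomp : ∀ h ∈ M, r h g := by
        intro h hh
        by_contra hn
        exact hgb (Finset.mem_biUnion.2 ⟨h, hh, Finset.mem_filter.2 ⟨hgG, hn⟩⟩)
      exact ⟨fun hgM => hirr g hgG (hcomp g hgM), hcomp⟩
    have h1 : G.card - j * D ≤ (G \ bad).card := by
      have := Finset.le_card_sdiff bad G
      omega
    refine h1.trans ?_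
    rw [← Finset.card_image_of_injOn (s := G \ bad) (f := fun g => insert g M)]
    · refine Finset.card_le_card fun M' hM' => ?_
      obtain ⟨g, hg, rfl⟩ := Finset.mem_image.1 hM'
      obtain ⟨hgM, hcomp⟩ := hnot g hg
      rw [Finset.mem_bipartiteAbove]
      refine ⟨mem_matchings.2 ⟨⟨?_, ?_⟩, ?_⟩, Finset.subset_insert _ _⟩
      · exact Finset.insert_subset (Finset.mem_sdiff.1 hg).1 hMG
      · rw [Finset.card_insert_of_notMem hgM, hMc]
      · rw [Finset.coe_insert]
        exact hMr.insert fun h hh _ => ⟨hsymm _ _ (hcomp h hh), hcomp h hh⟩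
    · intro g hg g' hg' h
      have h2 : g ∈ insert g' M := by
        have : insert g M = insert g' M := h
        rw [← this]; exact Finset.mem_insert_self _ _
      rcases Finset.mem_insert.1 h2 with h2 | h2
      · exact h2
      · exact absurd h2 (hnot g (Finset.mem_coe.1 hg)).1
  · obtain ⟨⟨-, hMc⟩, -⟩ := mem_matchings.1 hM'
    have : Finset.bipartiteBelow (fun M M' : Finset τ => M ⊆ M') (matchings G r j) M'
        ⊆ M'.powersetCard j := by
      intro M hM
      rw [Finset.mem_bipartiteBelow] at hM
      exact Finset.mem_powersetCard.2 ⟨hM.2, (mem_matchings.1 hM.1).1.2⟩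
    refine (Finset.card_le_card this).trans ?_
    rw [Finset.card_powersetCard, hMc, Nat.choose_succ_self_right]

/-- If every element is incompatible with few others, there are many matchings. -/
theorem card_pow_le_card_matchings {G : Finset τ} {r : τ → τ → Prop} [DecidableRel r] (hsymm : ∀ g h, r g h → r h g)
    (hirr : ∀ g ∈ G, ¬ r g g) {D : ℕ}
    (hD : ∀ h ∈ G, (G.filter fun g => ¬ r h g).card ≤ D) {m : ℕ} (hm : 2 * m * D ≤ G.card) :
    G.card ^ m ≤ (2 * m) ^ m * (matchings G r m).card := by
  have key : ∀ j ≤ m, G.card ^ j ≤ 2 ^ j * j.factorial * (matchings G r j).card := by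
    intro j
    induction j with
    | zero =>
      intro _
      have : ∅ ∈ matchings G r 0 := mem_matchings.2 ⟨⟨by simp, rfl⟩, by simp⟩
      have := Finset.card_pos.2 ⟨_, this⟩
      simpa using this
    | succ j ih =>
      intro hj
      have h1 := card_matchings_mul_le hsymm hirr hD j
      -- At every stage up to m at least half of G is still available, so each extension loses only
      -- a factor 2.
      have h2 : G.card ≤ 2 * (G.card - j * D) := by
        have : j * D ≤ m * D := Nat.mul_le_mul_right _ (by omega)
        have : 2 * (m * D) ≤ G.card := by rw [← mul_assoc]; exact hm
        omega
      calc G.card ^ (j + 1) = G.card ^ j * G.card := pow_succ _ _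
        _ ≤ (2 ^ j * j.factorial * (matchings G r j).card) * (2 * (G.card - j * D)) :=
          Nat.mul_le_mul (ih (by omega)) h2
        _ = 2 ^ (j + 1) * j.factorial * ((matchings G r j).card * (G.card - j * D)) := by ring
        _ ≤ 2 ^ (j + 1) * j.factorial * ((matchings G r (j + 1)).card * (j + 1)) :=
          Nat.mul_le_mul_left _ h1
        _ = _ := by rw [Nat.factorial_succ]; ring
  refine (key m le_rfl).trans (Nat.mul_le_mul_right _ ?_)
  rw [mul_pow]
  exact Nat.mul_le_mul_left _ (Nat.factorial_le_pow m)

theorem le_card_matchings {G : Finset τ} {r : τ → τ → Prop} [DecidableRel r] (hsymm : ∀ g h, r g h → r h g)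
    (hirr : ∀ g ∈ G, ¬ r g g) {D : ℕ}
    (hD : ∀ h ∈ G, (G.filter fun g => ¬ r h g).card ≤ D) {m : ℕ} (hm0 : 0 < m)
    (hm : 2 * m * D ≤ G.card) : (D : ℝ) ^ m ≤ (matchings G r m).card := by
  have h1 := card_pow_le_card_matchings hsymm hirr hD hm
  have h2 : (2 * m) ^ m * D ^ m ≤ (2 * m) ^ m * (matchings G r m).card := by
    rw [← mul_pow]; exact (Nat.pow_le_pow_left hm m).trans h1
  have h3 := Nat.le_of_mul_le_mul_left h2 (by positivity)
  exact_mod_cast h3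

/-- A set of size `y * q` has at most `(3 * y) ^ q` subsets of size at most `q`. -/
theorem card_filter_powerset_le (X : Finset δ) {y : ℝ} (hy : 1 ≤ y) {q : ℕ}
    (hX : (X.card : ℝ) ≤ y * q) :
    ((X.powerset.filter fun T => T.card ≤ q).card : ℝ) ≤ (3 * y) ^ q := by
  have hy0 : 0 < y := by linarith
  -- Weight a subset T by y^(-|T|). The total weight is at most exp(|X| / y) ≤ 3 ^ q, and every
  -- counted subset weighs at least y^(-q).
  have h1 : ∑ T ∈ X.powerset, (y⁻¹) ^ T.card = (1 + y⁻¹) ^ X.card := by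
    have := Finset.sum_pow_mul_eq_add_pow (y⁻¹) 1 X
    simp only [one_pow, mul_one] at this
    rw [this, add_comm]
  have h2 : (1 + y⁻¹) ^ X.card ≤ 3 ^ q := by
    calc (1 + y⁻¹) ^ X.card ≤ (Real.exp (y⁻¹)) ^ X.card :=
          pow_le_pow_left₀ (by positivity) (by rw [add_comm]; exact Real.add_one_le_exp _) _
      _ = Real.exp (X.card * y⁻¹) := by rw [← Real.exp_nat_mul]
      _ ≤ Real.exp (q * 1) := by
          refine Real.exp_le_exp.2 ?_
          rw [mul_one, ← div_eq_mul_inv, div_le_iff₀ hy0, mul_comm]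
          exact hX
      _ = Real.exp 1 ^ q := by rw [Real.exp_nat_mul]
      _ ≤ 3 ^ q := pow_le_pow_left₀ (Real.exp_pos _).le
          (by have := Real.exp_one_lt_d9; linarith) _
  have h3 : ((X.powerset.filter fun T => T.card ≤ q).card : ℝ) * (y⁻¹) ^ q
      ≤ ∑ T ∈ X.powerset, (y⁻¹) ^ T.card := by
    rw [← nsmul_eq_mul]
    refine (Finset.card_nsmul_le_sum _ (fun T => (y⁻¹) ^ T.card) _ fun T hT => ?_).trans
      (Finset.sum_le_sum_of_subset_of_nonneg (Finset.filter_subset _ _) fun _ _ _ => by positivity)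
    exact pow_le_pow_of_le_one (by positivity) (inv_le_one_of_one_le₀ hy) (Finset.mem_filter.1 hT).2
  rw [h1, inv_pow, ← div_eq_mul_inv] at h3
  have h4 := (div_le_iff₀ (by positivity)).1 (h3.trans h2)
  rwa [← mul_pow] at h4

end Counting

variable {ι α β γ : Type*} [DecidableEq α] [DecidableEq β] [DecidableEq γ] [DecidableEq ι]

/-- All degrees in the nonempty set of edges `S` are zero or two. -/
structure IsTwoRegular (pA : ι → α) (pB : ι → β) (pC : ι → γ) (S : Finset ι) : Prop where
  nonempty : S.Nonempty
  degA : ∀ e ∈ S, (S.filter fun f => pA f = pA e).card = 2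
  degB : ∀ e ∈ S, (S.filter fun f => pB f = pB e).card = 2
  degC : ∀ e ∈ S, (S.filter fun f => pC f = pC e).card = 2

/-- Each covered vertex lies in one edge of M and one of M'. If these coincide they cancel;
otherwise both survive in the symmetric difference. -/
theorem card_filter_symmDiff_eq_two {δ : Type*} [DecidableEq δ] {p : ι → δ} {M M' : Finset ι}
    (hM : Set.InjOn p M) (hM' : Set.InjOn p M') (him : M.image p = M'.image p) {e : ι}
    (he : e ∈ symmDiff M M') : ((symmDiff M M').filter fun f => p f = p e).card = 2 := by
  wlog h : e ∈ M ∧ e ∉ M' generalizing M M'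
  · rw [symmDiff_comm] at he ⊢
    refine this hM' hM him.symm he ?_
    rw [Finset.mem_symmDiff] at he
    tauto
  obtain ⟨heM, heM'⟩ := h
  obtain ⟨e', he', hee'⟩ := Finset.mem_image.1 (him ▸ Finset.mem_image_of_mem p heM)
  have he'M : e' ∉ M := fun h => heM' (hM h heM hee' ▸ he')
  have : (symmDiff M M').filter (fun f => p f = p e) = {e, e'} := by
    ext f
    simp only [Finset.mem_filter, Finset.mem_symmDiff, Finset.mem_insert, Finset.mem_singleton]
    constructor
    · rintro ⟨⟨hf, -⟩ | ⟨hf, -⟩, hfe⟩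
      · exact Or.inl (hM hf heM hfe)
      · exact Or.inr (hM' hf he' (hfe.trans hee'.symm))
    · rintro (rfl | rfl)
      · exact ⟨Or.inl ⟨heM, heM'⟩, rfl⟩
      · exact ⟨Or.inr ⟨he', he'M⟩, hee'⟩
  rw [this, Finset.card_pair]
  rintro rfl
  exact heM' he'

/-- Two different matchings with the same vertex set form a two-regular hypergraph. -/
theorem exists_isTwoRegular_of_balanced {pA : ι → α} {pB : ι → β} {pC : ι → γ} {E : Finset ι}
    {ΔA ΔB ΔC K : ℕ} (hA : ∀ a, (E.filter fun e => pA e = a).card ≤ ΔA)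
    (hB : ∀ b, (E.filter fun e => pB e = b).card ≤ ΔB)
    (hC : ∀ c, (E.filter fun e => pC e = c).card ≤ ΔC)
    (hKA : (E.image pA).card * ΔA ≤ K * E.card) (hKB : (E.image pB).card * ΔB ≤ K * E.card)
    (hKC : (E.image pC).card * ΔC ≤ K * E.card) (hA0 : 0 < ΔA) (hB0 : 0 < ΔB) (hK : 0 < K)
    (hAC : ΔA ≤ ΔC) (hBC : ΔB ≤ ΔC) (hE : 6 * ΔC ≤ E.card)
    (hbal : 15552 * K ^ 3 * ΔC < ΔA * ΔB) : ∃ S ⊆ E, IsTwoRegular pA pB pC S := by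
  classical
  have hC0 : 0 < ΔC := by omega
  -- An edge conflicts with at most 3 * ΔC edges, so this is the largest m with 2 * m * (3 * ΔC) ≤
  -- |E|.
  set m := E.card / (6 * ΔC) with hm
  have hm0 : 0 < m := Nat.div_pos hE (by omega)
  have hm1 : m * (6 * ΔC) ≤ E.card := Nat.div_mul_le_self _ _
  have hm2 : E.card < 12 * ΔC * m := by
    have h2 : E.card < m * (6 * ΔC) + 6 * ΔC := Nat.lt_div_mul_add (by omega)
    nlinarith
  set r : ι → ι → Prop := fun e f => pA e ≠ pA f ∧ pB e ≠ pB f ∧ pC e ≠ pC f with hr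
  have hD : ∀ h ∈ E, (E.filter fun g => ¬ r h g).card ≤ 3 * ΔC := by
    intro h _
    have : (E.filter fun g => ¬ r h g) ⊆ (E.filter fun e => pA e = pA h)
        ∪ ((E.filter fun e => pB e = pB h) ∪ (E.filter fun e => pC e = pC h)) := by
      intro g hg
      simp only [hr, Finset.mem_filter, Finset.mem_union, ne_eq] at hg ⊢
      have e1 : pA h = pA g ↔ pA g = pA h := eq_comm
      have e2 : pB h = pB g ↔ pB g = pB h := eq_comm
      have e3 : pC h = pC g ↔ pC g = pC h := eq_comm
      tauto
    refine (Finset.card_le_card this).trans ((Finset.card_union_le _ _).trans ?_)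
    have := Finset.card_union_le (E.filter fun e => pB e = pB h) (E.filter fun e => pC e = pC h)
    have := hA (pA h)
    have := hB (pB h)
    have := hC (pC h)
    omega
  have hcount := le_card_matchings (G := E) (r := r) (D := 3 * ΔC) (m := m)
    (fun e f h => ⟨h.1.symm, h.2.1.symm, h.2.2.symm⟩) (fun e _ h => h.1 rfl) hD hm0 (by linarith)
  have hsize : ∀ (c Δ : ℕ), 0 < Δ → Δ ≤ ΔC → c * Δ ≤ K * E.card →
      (1 : ℝ) ≤ 12 * K * ΔC / Δ ∧ (c : ℝ) ≤ 12 * K * ΔC / Δ * m := by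
    intro c Δ hΔ hΔC hKΔ
    have hΔ' : (0 : ℝ) < Δ := by exact_mod_cast hΔ
    constructor
    · rw [one_le_div hΔ']
      have : Δ ≤ 12 * K * ΔC := by nlinarith
      exact_mod_cast this
    · rw [div_mul_eq_mul_div, le_div_iff₀ hΔ']
      have : c * Δ ≤ 12 * K * ΔC * m := by nlinarith
      exact_mod_cast this
  set FA := (E.image pA).powerset.filter fun T => T.card ≤ m with hFA
  set FB := (E.image pB).powerset.filter fun T => T.card ≤ m with hFB
  set FC := (E.image pC).powerset.filter fun T => T.card ≤ m with hFC
  have cA : (FA.card : ℝ) ≤ _ :=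
    card_filter_powerset_le _ (hsize _ ΔA hA0 hAC hKA).1 (hsize _ ΔA hA0 hAC hKA).2
  have cB : (FB.card : ℝ) ≤ _ :=
    card_filter_powerset_le _ (hsize _ ΔB hB0 hBC hKB).1 (hsize _ ΔB hB0 hBC hKB).2
  have cC : (FC.card : ℝ) ≤ _ :=
    card_filter_powerset_le _ (hsize _ ΔC hC0 le_rfl hKC).1 (hsize _ ΔC hC0 le_rfl hKC).2
  have hlt : (FA ×ˢ (FB ×ˢ FC)).card < (matchings E r m).card := by
    have : ((FA ×ˢ (FB ×ˢ FC)).card : ℝ) < (matchings E r m).card := by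
      refine lt_of_lt_of_le ?_ hcount
      rw [Finset.card_product, Finset.card_product, Nat.cast_mul, Nat.cast_mul]
      have hA' : (0 : ℝ) < ΔA := by exact_mod_cast hA0
      have hB' : (0 : ℝ) < ΔB := by exact_mod_cast hB0
      have hC' : (0 : ℝ) < ΔC := by exact_mod_cast hC0
      refine lt_of_le_of_lt (mul_le_mul cA (mul_le_mul cB cC (Nat.cast_nonneg _) (by positivity))
        (by positivity) (by positivity)) ?_
      rw [← mul_pow, ← mul_pow]
      refine pow_lt_pow_left₀ ?_ (by positivity) hm0.ne'
      have hbal' : (15552 * K ^ 3 * ΔC : ℝ) < ΔA * ΔB := by exact_mod_cast hbal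
      -- Comparison of m-th roots: vertex sets against 3 * ΔC for matchings. The constant is 15552 =
      -- 36³ / 3.
      have : (3 * (12 * K * ΔC / ΔA) * (3 * (12 * K * ΔC / ΔB) * (3 * (12 * K * ΔC / ΔC))) : ℝ)
          = 3 * ΔC * (15552 * K ^ 3 * ΔC / (ΔA * ΔB)) := by
        field_simp
        ring
      rw [this]
      push_cast
      exact mul_lt_of_lt_one_right (by positivity) ((div_lt_one (by positivity)).2 hbal')
    exact_mod_cast this
  obtain ⟨M, hM, M', hM', hne, heq⟩ := Finset.exists_ne_map_eq_of_card_lt_of_maps_to hlt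
    (f := fun M => (M.image pA, M.image pB, M.image pC)) (fun M hM => by
      obtain ⟨⟨hME, hMc⟩, -⟩ := mem_matchings.1 (Finset.mem_coe.1 hM)
      simp only [Finset.coe_product, Set.mem_prod, Finset.mem_coe, hFA, hFB, hFC,
        Finset.mem_filter, Finset.mem_powerset]
      exact ⟨⟨Finset.image_subset_image hME, Finset.card_image_le.trans hMc.le⟩,
        ⟨Finset.image_subset_image hME, Finset.card_image_le.trans hMc.le⟩,
        ⟨Finset.image_subset_image hME, Finset.card_image_le.trans hMc.le⟩⟩)
  simp only [Prod.mk.injEq] at heq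
  obtain ⟨⟨hME, -⟩, hMr⟩ := mem_matchings.1 hM
  obtain ⟨⟨hME', -⟩, hMr'⟩ := mem_matchings.1 hM'
  refine ⟨symmDiff M M', ?_, ?_, fun e he => ?_, fun e he => ?_, fun e he => ?_⟩
  · exact Finset.union_subset (Finset.sdiff_subset.trans hME) (Finset.sdiff_subset.trans hME')
  · rw [Finset.nonempty_iff_ne_empty]
    exact fun h => hne (symmDiff_eq_bot.1 h)
  · refine card_filter_symmDiff_eq_two ?_ ?_ heq.1 he
    · exact fun x hx y hy h => by_contra fun hxy => (hMr hx hy hxy).1 h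
    · exact fun x hx y hy h => by_contra fun hxy => (hMr' hx hy hxy).1 h
  · refine card_filter_symmDiff_eq_two ?_ ?_ heq.2.1 he
    · exact fun x hx y hy h => by_contra fun hxy => (hMr hx hy hxy).2.1 h
    · exact fun x hx y hy h => by_contra fun hxy => (hMr' hx hy hxy).2.1 h
  · refine card_filter_symmDiff_eq_two ?_ ?_ heq.2.2 he
    · exact fun x hx y hy h => by_contra fun hxy => (hMr hx hy hxy).2.2 h
    · exact fun x hx y hy h => by_contra fun hxy => (hMr' hx hy hxy).2.2 h

end Tripartite

/-! ### Packing rainbow cycles, and the unbalanced case -/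

namespace Tripartite

variable {ι α β γ : Type*} [DecidableEq α] [DecidableEq β] [DecidableEq γ] [DecidableEq ι]

/-- A family of rainbow cycles in `E` of length at most `l` which are vertex-disjoint in the first
two parts and such that no vertex of the third part lies in more than `s` of them. -/
structure IsPacking (pA : ι → α) (pB : ι → β) (pC : ι → γ) (E : Finset ι) (l s : ℕ)
    (G : Finset (Finset ι)) : Prop where
  subset : ∀ g ∈ G, g ⊆ E
  rainbow : ∀ g ∈ G, IsRainbow pA pB pC g
  card_le : ∀ g ∈ G, g.card ≤ l
  disjA : (G : Set (Finset ι)).PairwiseDisjoint fun g => g.image pA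
  disjB : (G : Set (Finset ι)).PairwiseDisjoint fun g => g.image pB
  load : ∀ c, (G.filter fun g => c ∈ g.image pC).card ≤ s

theorem card_filter_mem_le {δ : Type*} [DecidableEq δ] {p : ι → δ} {E : Finset ι} {Δ : ℕ}
    (h : ∀ d, (E.filter fun e => p e = d).card ≤ Δ) (U : Finset δ) :
    (E.filter fun e => p e ∈ U).card ≤ U.card * Δ := by
  have : (E.filter fun e => p e ∈ U) ⊆ U.biUnion fun d => E.filter fun e => p e = d := by
    intro e he
    rw [Finset.mem_filter] at he
    exact Finset.mem_biUnion.2 ⟨p e, he.2, Finset.mem_filter.2 ⟨he.1, rfl⟩⟩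
  exact (Finset.card_le_card this).trans (Finset.card_biUnion_le_card_mul _ _ _ fun d _ => h d)

/-- Greedy choice: j cycles use at most j * l vertices in each of the first two parts and saturate
at most j * l / s colours. Since ΔA ≤ ΔB and ΔC ≤ s * ΔB, deleting each of the three kinds costs at
most j * l * ΔB edges, so half of E remains. -/
theorem exists_isPacking {pA : ι → α} {pB : ι → β} {pC : ι → γ} {E : Finset ι} {ΔA ΔB ΔC l s : ℕ}
    (hA : ∀ a, (E.filter fun e => pA e = a).card ≤ ΔA)
    (hB : ∀ b, (E.filter fun e => pB e = b).card ≤ ΔB)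
    (hC : ∀ c, (E.filter fun e => pC e = c).card ≤ ΔC) (hAB : ΔA ≤ ΔB) (hs : ΔC ≤ s * ΔB)
    (hcyc : ∀ F ⊆ E, E.card ≤ 2 * F.card → ∃ S ⊆ F, IsRainbow pA pB pC S ∧ S.card ≤ l) (j : ℕ)
    (hj : 6 * j * l * ΔB ≤ E.card) :
    ∃ G : Finset (Finset ι), G.card = j ∧ IsPacking pA pB pC E l s G := by
  induction j with
  | zero => exact ⟨∅, rfl, by simp, by simp, by simp, by simp, by simp, by simp⟩
  | succ j ih =>
    obtain ⟨G, hGc, hG⟩ := ih (le_trans (by gcongr; omega) hj)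
    set UA := G.biUnion fun g => g.image pA with hUA
    set UB := G.biUnion fun g => g.image pB with hUB
    set UC := (E.image pC).filter fun c => s ≤ (G.filter fun g => c ∈ g.image pC).card with hUC
    have cA : UA.card ≤ j * l := hGc ▸ Finset.card_biUnion_le_card_mul _ _ _ fun g hg =>
      Finset.card_image_le.trans (hG.card_le g hg)
    have cB : UB.card ≤ j * l := hGc ▸ Finset.card_biUnion_le_card_mul _ _ _ fun g hg =>
      Finset.card_image_le.trans (hG.card_le g hg)
    have cC : UC.card * s ≤ j * l := by
      rw [← hGc]
      refine Finset.card_mul_le_card_mul (fun (c : γ) (g : Finset ι) => c ∈ g.image pC)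
        (fun c hc => (Finset.mem_filter.1 hc).2) fun g hg => ?_
      refine le_trans (Finset.card_le_card fun c hc => ?_)
        (Finset.card_image_le.trans (hG.card_le g hg) : (g.image pC).card ≤ l)
      exact (Finset.mem_bipartiteBelow _).1 hc |>.2
    set F := E.filter fun e => pA e ∉ UA ∧ pB e ∉ UB ∧ pC e ∉ UC with hF
    have hFc : E.card ≤ 2 * F.card := by
      have hcov : E ⊆ F ∪ ((E.filter fun e => pA e ∈ UA) ∪ ((E.filter fun e => pB e ∈ UB)
          ∪ (E.filter fun e => pC e ∈ UC))) := by
        intro e he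
        simp only [hF, Finset.mem_union, Finset.mem_filter, he, true_and]
        tauto
      have h1 := (Finset.card_le_card hcov).trans (Finset.card_union_le _ _)
      have h2 := Finset.card_union_le (E.filter fun e => pA e ∈ UA)
        ((E.filter fun e => pB e ∈ UB) ∪ (E.filter fun e => pC e ∈ UC))
      have h3 := Finset.card_union_le (E.filter fun e => pB e ∈ UB) (E.filter fun e => pC e ∈ UC)
      have h4 := card_filter_mem_le hA UA
      have h5 := card_filter_mem_le hB UB
      have h6 := card_filter_mem_le hC UC
      have h7 : UA.card * ΔA ≤ j * l * ΔB := Nat.mul_le_mul cA hAB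
      have h8 : UB.card * ΔB ≤ j * l * ΔB := Nat.mul_le_mul_right _ cB
      have h9 : UC.card * ΔC ≤ j * l * ΔB := by
        calc UC.card * ΔC ≤ UC.card * (s * ΔB) := Nat.mul_le_mul_left _ hs
          _ = UC.card * s * ΔB := by ring
          _ ≤ _ := Nat.mul_le_mul_right _ cC
      have h10 : 6 * (j * l * ΔB) ≤ E.card := by
        refine le_trans ?_ hj
        calc 6 * (j * l * ΔB) = 6 * j * l * ΔB := by ring
          _ ≤ 6 * (j + 1) * l * ΔB := by gcongr; omega
      omega
    obtain ⟨S, hSF, hS, hSl⟩ := hcyc F (Finset.filter_subset _ _) hFc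
    have hSE : S ⊆ E := hSF.trans (Finset.filter_subset _ _)
    have dA : ∀ g ∈ G, Disjoint (S.image pA) (g.image pA) := by
      intro g hg
      rw [Finset.disjoint_left]
      intro a ha hag
      obtain ⟨e, he, rfl⟩ := Finset.mem_image.1 ha
      exact (Finset.mem_filter.1 (hSF he)).2.1 (Finset.mem_biUnion.2 ⟨g, hg, hag⟩)
    have dB : ∀ g ∈ G, Disjoint (S.image pB) (g.image pB) := by
      intro g hg
      rw [Finset.disjoint_left]
      intro a ha hag
      obtain ⟨e, he, rfl⟩ := Finset.mem_image.1 ha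
      exact (Finset.mem_filter.1 (hSF he)).2.2.1 (Finset.mem_biUnion.2 ⟨g, hg, hag⟩)
    have hSG : S ∉ G := by
      intro h
      have := dA S h
      rw [disjoint_self] at this
      exact (hS.nonempty.image pA).ne_empty this
    refine ⟨insert S G, by rw [Finset.card_insert_of_notMem hSG, hGc], ?_, ?_, ?_, ?_, ?_, ?_⟩
    · exact Finset.forall_mem_insert _ _ _ |>.2 ⟨hSE, hG.subset⟩
    · exact Finset.forall_mem_insert _ _ _ |>.2 ⟨hS, hG.rainbow⟩
    · exact Finset.forall_mem_insert _ _ _ |>.2 ⟨hSl, hG.card_le⟩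
    · rw [Finset.coe_insert]
      exact hG.disjA.insert fun g hg _ => dA g hg
    · rw [Finset.coe_insert]
      exact hG.disjB.insert fun g hg _ => dB g hg
    · intro c
      rw [Finset.filter_insert]
      split_ifs with hc
      · obtain ⟨e, he, rfl⟩ := Finset.mem_image.1 hc
        have h1 := (Finset.mem_filter.1 (hSF he)).2.2.2
        have h2 : (G.filter fun g => pC e ∈ g.image pC).card < s := by
          by_contra hn
          exact h1 (Finset.mem_filter.2 ⟨Finset.mem_image_of_mem _ (hSE he), not_lt.1 hn⟩)
        exact (Finset.card_insert_le _ _).trans h2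
      · exact hG.load c

/-- In the union of vertex-disjoint sets of edges, degrees are inherited. -/
theorem card_filter_biUnion_eq {δ : Type*} [DecidableEq δ] {p : ι → δ} {G : Finset (Finset ι)}
    (hd : (G : Set (Finset ι)).PairwiseDisjoint fun g => g.image p)
    (hdeg : ∀ g ∈ G, ∀ e ∈ g, (g.filter fun f => p f = p e).card = 2) {e : ι}
    (he : e ∈ G.biUnion id) : ((G.biUnion id).filter fun f => p f = p e).card = 2 := by
  obtain ⟨g, hg, heg⟩ := Finset.mem_biUnion.1 he
  rw [← hdeg g hg e heg]
  congr 1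
  ext f
  simp only [Finset.mem_filter, Finset.mem_biUnion, id]
  constructor
  · rintro ⟨⟨h, hh, hf⟩, hfe⟩
    obtain rfl : h = g := by
      by_contra hne
      exact Finset.disjoint_left.1 (hd hh hg hne) (Finset.mem_image_of_mem p hf)
        (hfe ▸ Finset.mem_image_of_mem p heg)
    exact ⟨hf, hfe⟩
  · rintro ⟨hf, hfe⟩
    exact ⟨⟨g, hg, hf⟩, hfe⟩

/-- Two families of cycles with disjoint colour sets, which use the same colours. -/
theorem card_filter_biUnion_symmDiff_eq_two {δ : Type*} [DecidableEq δ] {p : ι → δ}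
    {M M' : Finset (Finset ι)} (hinj : ∀ g ∈ M ∪ M', Set.InjOn p g)
    (hdis : (((M ∪ M' : Finset (Finset ι)) : Set (Finset ι)).Pairwise Disjoint))
    (hM : (M : Set (Finset ι)).PairwiseDisjoint fun g => g.image p)
    (hM' : (M' : Set (Finset ι)).PairwiseDisjoint fun g => g.image p)
    (him : M.biUnion (fun g => g.image p) = M'.biUnion fun g => g.image p) {e : ι}
    (he : e ∈ (symmDiff M M').biUnion id) :
    (((symmDiff M M').biUnion id).filter fun f => p f = p e).card = 2 := by
  obtain ⟨g, hg, heg⟩ := Finset.mem_biUnion.1 he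
  wlog h : g ∈ M ∧ g ∉ M' generalizing M M'
  · rw [symmDiff_comm] at he hg ⊢
    rw [Finset.union_comm] at hinj hdis
    refine this hinj hdis hM' hM him.symm he hg ?_
    rw [Finset.mem_symmDiff] at hg
    tauto
  obtain ⟨hgM, hgM'⟩ := h
  rw [id] at heg
  -- Within one colour-disjoint family of rainbow cycles, a colour determines both its cycle and its
  -- edge.
  have uniq : ∀ {N : Finset (Finset ι)},
      (N : Set (Finset ι)).PairwiseDisjoint (fun g => g.image p) → N ⊆ M ∪ M' →
      ∀ g ∈ N, ∀ h ∈ N, ∀ e ∈ g, ∀ f ∈ h, p e = p f → g = h ∧ e = f := by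
    intro N hN hsub g hg h hh e he f hf hef
    obtain rfl : g = h := by
      by_contra hne
      exact Finset.disjoint_left.1 (hN hg hh hne) (Finset.mem_image_of_mem p he)
        (hef ▸ Finset.mem_image_of_mem p hf)
    exact ⟨rfl, hinj g (hsub hg) he hf hef⟩
  have hex : p e ∈ M'.biUnion fun g => g.image p :=
    him ▸ Finset.mem_biUnion.2 ⟨g, hgM, Finset.mem_image_of_mem p heg⟩
  obtain ⟨h, hhM', hh⟩ := Finset.mem_biUnion.1 hex
  obtain ⟨e', he', hee'⟩ := Finset.mem_image.1 hh
  have hhM : h ∉ M := fun hM0 =>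
    hgM' ((uniq hM Finset.subset_union_left h hM0 g hgM e' he' e heg hee').1 ▸ hhM')
  have : ((symmDiff M M').biUnion id).filter (fun f => p f = p e) = {e, e'} := by
    ext f
    simp only [Finset.mem_filter, Finset.mem_biUnion, Finset.mem_symmDiff, Finset.mem_insert,
      Finset.mem_singleton, id]
    constructor
    · rintro ⟨⟨g', ⟨hg', -⟩ | ⟨hg', -⟩, hf⟩, hfe⟩
      · exact Or.inl (uniq hM Finset.subset_union_left g' hg' g hgM f hf e heg hfe).2
      · exact Or.inr (uniq hM' Finset.subset_union_right g' hg' h hhM' f hf e' he'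
          (hfe.trans hee'.symm)).2
    · rintro (rfl | rfl)
      · exact ⟨⟨g, Or.inl ⟨hgM, hgM'⟩, heg⟩, rfl⟩
      · exact ⟨⟨h, Or.inr ⟨hhM', hhM⟩, he'⟩, hee'⟩
  rw [this, Finset.card_pair]
  rintro rfl
  refine Finset.disjoint_left.1 (hdis (Finset.mem_coe.2 (Finset.mem_union_left _ hgM))
    (Finset.mem_coe.2 (Finset.mem_union_right _ hhM')) ?_) heg he'
  rintro rfl
  exact hgM' hhM'

/-- If short rainbow cycles are abundant and the third part is small, there is a two-regular
subhypergraph. -/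
theorem exists_isTwoRegular_of_rainbow {pA : ι → α} {pB : ι → β} {pC : ι → γ} {E : Finset ι}
    {ΔA ΔB ΔC K l s : ℕ} (hA : ∀ a, (E.filter fun e => pA e = a).card ≤ ΔA)
    (hB : ∀ b, (E.filter fun e => pB e = b).card ≤ ΔB)
    (hC : ∀ c, (E.filter fun e => pC e = c).card ≤ ΔC)
    (hKC : (E.image pC).card * ΔC ≤ K * E.card) (hAB : ΔA ≤ ΔB) (hB0 : 0 < ΔB) (hC0 : 0 < ΔC)
    (hK : 0 < K) (hl : 0 < l) (hs : ΔC ≤ s * ΔB) (hs' : s * ΔB ≤ 2 * ΔC)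
    (hcyc : ∀ F ⊆ E, E.card ≤ 2 * F.card → ∃ S ⊆ F, IsRainbow pA pB pC S ∧ S.card ≤ l)
    (hE : 24 * l ^ 2 * ΔC ≤ E.card) (hsl : (288 * K * l) ^ l < l * s) :
    ∃ S ⊆ E, IsTwoRegular pA pB pC S := by
  classical
  have hs0 : 0 < s := by
    rcases Nat.eq_zero_or_pos s with rfl | h
    · omega
    · exact h
  set N' := E.card / (6 * l * ΔB) with hN'
  have hN1 : 6 * N' * l * ΔB ≤ E.card := by
    have := Nat.div_mul_le_self E.card (6 * l * ΔB)
    calc 6 * N' * l * ΔB = N' * (6 * l * ΔB) := by ring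
      _ ≤ _ := this
  have hN2 : 2 * l * s ≤ N' := by
    rw [hN', Nat.le_div_iff_mul_le (by positivity)]
    calc 2 * l * s * (6 * l * ΔB) = 12 * l ^ 2 * (s * ΔB) := by ring
      _ ≤ 12 * l ^ 2 * (2 * ΔC) := Nat.mul_le_mul_left _ hs'
      _ ≤ _ := le_trans (le_of_eq (by ring)) hE
  have hN0 : 0 < N' := lt_of_lt_of_le (by positivity) hN2
  have hN3 : E.card < 12 * l * ΔB * N' := by
    have h2 : E.card < N' * (6 * l * ΔB) + 6 * l * ΔB := Nat.lt_div_mul_add (by positivity)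
    have h3 : 6 * l * ΔB ≤ N' * (6 * l * ΔB) := Nat.le_mul_of_pos_left _ hN0
    calc E.card < N' * (6 * l * ΔB) + N' * (6 * l * ΔB) := by omega
      _ = _ := by ring
  -- A cycle has at most l colours, each in at most s cycles of the packing, so it conflicts with at
  -- most l * s cycles.
  set m := N' / (2 * l * s) with hm
  have hm0 : 0 < m := Nat.div_pos hN2 (by positivity)
  have hm1 : 2 * m * (l * s) ≤ N' := by
    have := Nat.div_mul_le_self N' (2 * l * s)
    calc 2 * m * (l * s) = m * (2 * l * s) := by ring
      _ ≤ _ := this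
  have hm2 : N' ≤ 4 * l * s * m := by
    have h2 : N' < m * (2 * l * s) + 2 * l * s := Nat.lt_div_mul_add (by positivity)
    have h3 : 2 * l * s ≤ m * (2 * l * s) := Nat.le_mul_of_pos_left _ hm0
    calc N' ≤ m * (2 * l * s) + m * (2 * l * s) := by omega
      _ = _ := by ring
  obtain ⟨G, hGc, hG⟩ := exists_isPacking hA hB hC hAB hs hcyc N' hN1
  set r : Finset ι → Finset ι → Prop := fun g h => Disjoint (g.image pC) (h.image pC) with hr
  have hD : ∀ h ∈ G, (G.filter fun g => ¬ r h g).card ≤ l * s := by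
    intro h hh
    have : (G.filter fun g => ¬ r h g)
        ⊆ (h.image pC).biUnion fun c => G.filter fun g => c ∈ g.image pC := by
      intro g hg
      obtain ⟨hgG, hg⟩ := Finset.mem_filter.1 hg
      obtain ⟨c, hc, hc'⟩ := Finset.not_disjoint_iff.1 hg
      exact Finset.mem_biUnion.2 ⟨c, hc, Finset.mem_filter.2 ⟨hgG, hc'⟩⟩
    refine (Finset.card_le_card this).trans
      ((Finset.card_biUnion_le_card_mul _ _ s fun c _ => hG.load c).trans ?_)
    exact Nat.mul_le_mul_right _ (Finset.card_image_le.trans (hG.card_le h hh))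
  have hcount := le_card_matchings (G := G) (r := r) (D := l * s) (m := m)
    (fun e f h => Disjoint.symm h) (fun g hg h => by
      rw [hr] at h
      exact ((hG.rainbow g hg).nonempty.image pC).ne_empty (disjoint_self.1 h)) hD hm0
    (by rw [hGc]; exact hm1)
  set FC := (E.image pC).powerset.filter fun T => T.card ≤ l * m with hFC
  have hsize : ((E.image pC).card : ℝ) ≤ (96 * K * l : ℝ) * (l * m : ℕ) := by
    have : (E.image pC).card * ΔC ≤ (96 * K * l * (l * m)) * ΔC := by
      refine hKC.trans ?_
      calc K * E.card ≤ K * (12 * l * ΔB * (4 * l * s * m)) :=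
            Nat.mul_le_mul_left _ (hN3.le.trans (Nat.mul_le_mul_left _ hm2))
        _ = 48 * K * l ^ 2 * m * (s * ΔB) := by ring
        _ ≤ 48 * K * l ^ 2 * m * (2 * ΔC) := Nat.mul_le_mul_left _ hs'
        _ = _ := by ring
    have := Nat.le_of_mul_le_mul_right this hC0
    exact_mod_cast this
  have cC : (FC.card : ℝ) ≤ (3 * (96 * K * l : ℝ)) ^ (l * m) :=
    card_filter_powerset_le _ (by
      have : 1 ≤ 96 * K * l := Nat.succ_le_of_lt (by positivity)
      exact_mod_cast this) hsize
  -- At most (288 * K * l) ^ (l * m) colour sets against at least (l * s) ^ m families; `hsl`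
  -- compares the m-th roots.
  have hlt : FC.card < (matchings G r m).card := by
    have : (FC.card : ℝ) < (matchings G r m).card := by
      refine lt_of_le_of_lt cC (lt_of_lt_of_le ?_ hcount)
      rw [pow_mul]
      refine pow_lt_pow_left₀ ?_ (by positivity) hm0.ne'
      have e : (3 * (96 * K * l) : ℝ) = ((288 * K * l : ℕ) : ℝ) := by push_cast; ring
      rw [e]
      exact_mod_cast hsl
    exact_mod_cast this
  obtain ⟨M, hM, M', hM', hne, heq⟩ := Finset.exists_ne_map_eq_of_card_lt_of_maps_to hlt
    (f := fun M => M.biUnion fun g => g.image pC) (fun M hM => by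
      obtain ⟨⟨hMG, hMc⟩, -⟩ := mem_matchings.1 (Finset.mem_coe.1 hM)
      rw [Finset.mem_coe, hFC, Finset.mem_filter, Finset.mem_powerset]
      refine ⟨Finset.biUnion_subset.2 fun g hg => Finset.image_subset_image
        (hG.subset g (hMG hg)), ?_⟩
      rw [← hMc, mul_comm]
      exact Finset.card_biUnion_le_card_mul _ _ _ fun g hg =>
        Finset.card_image_le.trans (hG.card_le g (hMG hg)))
  obtain ⟨⟨hMG, -⟩, hMr⟩ := mem_matchings.1 hM
  obtain ⟨⟨hMG', -⟩, hMr'⟩ := mem_matchings.1 hM'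
  have hsub : symmDiff M M' ⊆ G :=
    Finset.union_subset (Finset.sdiff_subset.trans hMG) (Finset.sdiff_subset.trans hMG')
  have hsub' : M ∪ M' ⊆ G := Finset.union_subset hMG hMG'
  refine ⟨(symmDiff M M').biUnion id, ?_, ?_, fun e he => ?_, fun e he => ?_, fun e he => ?_⟩
  · exact Finset.biUnion_subset.2 fun g hg => hG.subset g (hsub hg)
  · have : (symmDiff M M').Nonempty := by
      rw [Finset.nonempty_iff_ne_empty]
      exact fun h => hne (symmDiff_eq_bot.1 h)
    obtain ⟨g, hg⟩ := this
    obtain ⟨e, he⟩ := (hG.rainbow g (hsub hg)).nonempty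
    exact ⟨e, Finset.mem_biUnion.2 ⟨g, hg, he⟩⟩
  · exact card_filter_biUnion_eq (hG.disjA.subset (Finset.coe_subset.2 hsub))
      (fun g hg => (hG.rainbow g (hsub hg)).degA) he
  · exact card_filter_biUnion_eq (hG.disjB.subset (Finset.coe_subset.2 hsub))
      (fun g hg => (hG.rainbow g (hsub hg)).degB) he
  · refine card_filter_biUnion_symmDiff_eq_two (fun g hg => (hG.rainbow g (hsub' hg)).injOn)
      ?_ hMr hMr' heq he
    intro g hg h hh hgh
    have := hG.disjA (hsub' hg) (hsub' hh) hgh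
    rw [Finset.disjoint_left]
    intro e he he'
    exact Finset.disjoint_left.1 this (Finset.mem_image_of_mem pA he)
      (Finset.mem_image_of_mem pA he')

end Tripartite

/-! ### Almost regular hypergraphs and the dichotomy -/

namespace Tripartite

variable {ι α β γ : Type*} [DecidableEq α] [DecidableEq β] [DecidableEq γ] [DecidableEq ι]

/-- In one part, the maximum degree `Δ` exceeds the average degree by a factor of at most `K`. -/
structure IsAlmostRegular {δ : Type*} [DecidableEq δ] (p : ι → δ) (E : Finset ι) (Δ K : ℕ) :
    Prop where
  deg_le : ∀ d, (E.filter fun e => p e = d).card ≤ Δ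
  card_image_mul_le : (E.image p).card * Δ ≤ K * E.card

theorem IsLinearOn.swap_ab {pA : ι → α} {pB : ι → β} {pC : ι → γ} {E : Finset ι}
    (h : IsLinearOn pA pB pC E) : IsLinearOn pB pA pC E :=
  ⟨fun e he f hf h1 h2 => h.ab e he f hf h2 h1, h.ac, h.bc⟩

theorem IsLinearOn.swap_bc {pA : ι → α} {pB : ι → β} {pC : ι → γ} {E : Finset ι}
    (h : IsLinearOn pA pB pC E) : IsLinearOn pA pC pB E :=
  ⟨h.ac, fun e he f hf h1 h2 => h.bc e he f hf h2 h1, h.ab⟩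

theorem IsTwoRegular.swap_ab {pA : ι → α} {pB : ι → β} {pC : ι → γ} {S : Finset ι}
    (h : IsTwoRegular pA pB pC S) : IsTwoRegular pB pA pC S :=
  ⟨h.nonempty, h.degB, h.degA, h.degC⟩

theorem IsTwoRegular.swap_bc {pA : ι → α} {pB : ι → β} {pC : ι → γ} {S : Finset ι}
    (h : IsTwoRegular pA pB pC S) : IsTwoRegular pA pC pB S :=
  ⟨h.nonempty, h.degA, h.degC, h.degB⟩

variable [Fintype α] [Fintype β] [Fintype γ]

theorem exists_isTwoRegular_of_almostRegular_of_le {pA : ι → α} {pB : ι → β} {pC : ι → γ}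
    {E : Finset ι} {ΔA ΔB ΔC K n k T : ℕ} (hlin : IsLinearOn pA pB pC E) (hE0 : E.Nonempty)
    (hA : IsAlmostRegular pA E ΔA K) (hB : IsAlmostRegular pB E ΔB K)
    (hC : IsAlmostRegular pC E ΔC K) (hnA : Fintype.card α ≤ n) (hnB : Fintype.card β ≤ n)
    (hK : 0 < K) (hTA : T ≤ ΔA) (hAB : ΔA ≤ ΔB) (hBC : ΔB ≤ ΔC)
    (hT : 15552 * K ^ 3 * (288 * K * (2 * (k + 1))) ^ (2 * (k + 1)) ≤ T)
    (hT' : 2 * n * (8 * (2 * (k + 1)) ^ 2 * K ^ 2) ^ (k + 1) < T ^ (k + 1)) :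
    ∃ S ⊆ E, IsTwoRegular pA pB pC S := by
  set l := 2 * (k + 1) with hl
  have hl0 : 0 < l := by omega
  have hpow : (288 * K * l) ^ 2 ≤ (288 * K * l) ^ l :=
    Nat.pow_le_pow_right (by positivity) (by omega)
  have hTK : 24 * l ^ 2 * K ^ 2 ≤ T := by
    refine le_trans ?_ hT
    calc 24 * l ^ 2 * K ^ 2 ≤ (288 * K * l) ^ 2 := by
          nlinarith [Nat.zero_le (l ^ 2 * K ^ 2)]
      _ ≤ (288 * K * l) ^ l := hpow
      _ ≤ _ := Nat.le_mul_of_pos_left _ (by positivity)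
  have hT0 : 0 < T := lt_of_lt_of_le (by positivity) hTK
  have hN0 : 0 < E.card := hE0.card_pos
  -- By linearity edges inject into pairs of vertices of the last two parts. Combined with ΔB ≥ T
  -- this makes |E| large compared with ΔC.
  have hBC' : ΔB * ΔC ≤ K ^ 2 * E.card := by
    have h1 : E.card ≤ (E.image pB).card * (E.image pC).card := by
      rw [← Finset.card_product]
      refine Finset.card_le_card_of_injOn (fun e => (pB e, pC e)) (fun e he => ?_)
        fun e he f hf h => ?_
      · exact Finset.mem_product.2 ⟨Finset.mem_image_of_mem _ he, Finset.mem_image_of_mem _ he⟩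
      · exact hlin.bc e he f hf (Prod.ext_iff.1 h).1 (Prod.ext_iff.1 h).2
    refine Nat.le_of_mul_le_mul_right ?_ hN0
    calc ΔB * ΔC * E.card ≤ ΔB * ΔC * ((E.image pB).card * (E.image pC).card) :=
          Nat.mul_le_mul_left _ h1
      _ = ((E.image pB).card * ΔB) * ((E.image pC).card * ΔC) := by ring
      _ ≤ (K * E.card) * (K * E.card) :=
          Nat.mul_le_mul hB.card_image_mul_le hC.card_image_mul_le
      _ = _ := by ring
  have hEl : 24 * l ^ 2 * ΔC ≤ E.card := by
    refine Nat.le_of_mul_le_mul_left ?_ (pow_pos hK 2)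
    calc K ^ 2 * (24 * l ^ 2 * ΔC) = (24 * l ^ 2 * K ^ 2) * ΔC := by ring
      _ ≤ ΔB * ΔC := Nat.mul_le_mul_right _ (by omega)
      _ ≤ _ := hBC'
  by_cases hbal : 15552 * K ^ 3 * ΔC < ΔA * ΔB
  · refine exists_isTwoRegular_of_balanced hA.deg_le hB.deg_le hC.deg_le hA.card_image_mul_le
      hB.card_image_mul_le hC.card_image_mul_le (by omega) (by omega) hK (by omega) hBC
      (le_trans ?_ hEl) hbal
    refine Nat.mul_le_mul_right _ ?_
    have : 1 ≤ l ^ 2 := Nat.one_le_pow _ _ hl0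
    omega
  rw [not_lt] at hbal
  have hB0 : 0 < ΔB := by omega
  obtain ⟨s, hs, hs'⟩ : ∃ s, ΔC ≤ s * ΔB ∧ s * ΔB ≤ 2 * ΔC := by
    refine ⟨ΔC / ΔB + 1, ?_, ?_⟩
    · rw [add_mul, one_mul]; exact (Nat.lt_div_mul_add hB0).le
    · have := Nat.div_mul_le_self ΔC ΔB
      rw [add_mul, one_mul]; omega
  refine exists_isTwoRegular_of_rainbow hA.deg_le hB.deg_le hC.deg_le hC.card_image_mul_le hAB hB0
    (by omega) hK hl0 hs hs' (fun F hF hFE => ?_) hEl ?_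
  · have hF0 : F.Nonempty := Finset.card_pos.1 (by omega)
    refine exists_isRainbow hF0 (hlin.mono hF) (Δ := ΔB)
      (fun a => (Finset.card_le_card (Finset.filter_subset_filter _ hF)).trans
        ((hA.deg_le a).trans hAB))
      (fun b => (Finset.card_le_card (Finset.filter_subset_filter _ hF)).trans (hB.deg_le b)) ?_
    have ha : 0 < (F.image pA).card := (hF0.image _).card_pos
    have hb : 0 < (F.image pB).card := (hF0.image _).card_pos
    have ha' : (0 : ℝ) < (F.image pA).card := by exact_mod_cast ha
    have hb' : (0 : ℝ) < (F.image pB).card := by exact_mod_cast hb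
    have hK' : (0 : ℝ) < K := by exact_mod_cast hK
    have hB0' : (0 : ℝ) < ΔB := by exact_mod_cast hB0
    have hprod : (F.image pA).card * (F.image pB).card * (ΔA * ΔB) ≤ F.card ^ 2 * (4 * K ^ 2) := by
      calc (F.image pA).card * (F.image pB).card * (ΔA * ΔB)
          = ((F.image pA).card * ΔA) * ((F.image pB).card * ΔB) := by ring
        _ ≤ ((E.image pA).card * ΔA) * ((E.image pB).card * ΔB) := by
            gcongr
        _ ≤ (K * E.card) * (K * E.card) :=
            Nat.mul_le_mul hA.card_image_mul_le hB.card_image_mul_le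
        _ ≤ (K * (2 * F.card)) * (K * (2 * F.card)) := by gcongr
        _ = _ := by ring
    -- Cycles are sought with degree bound ΔB in both parts, so the density ΔA * ΔB / (4 * K ^ 2)
    -- beats it by the factor T / (4 * K ^ 2), as T ≤ ΔA. The factor 4 comes from keeping only half
    -- of the edges.
    have hr : (T * ΔB / (4 * K ^ 2) : ℝ)
        ≤ (F.card : ℝ) ^ 2 / ((F.image pA).card * (F.image pB).card) := by
      rw [div_le_div_iff₀ (by positivity) (by positivity)]
      have : T * ΔB * ((F.image pA).card * (F.image pB).card) ≤ F.card ^ 2 * (4 * K ^ 2) := by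
        refine le_trans ?_ hprod
        rw [mul_comm]
        gcongr
      exact_mod_cast this
    refine lt_of_lt_of_le ?_ (pow_le_pow_left₀ (by positivity) hr _)
    have hn : ((Fintype.card α + Fintype.card β : ℕ) : ℝ) ≤ 2 * n := by
      have : Fintype.card α + Fintype.card β ≤ 2 * n := by omega
      exact_mod_cast this
    refine lt_of_le_of_lt (mul_le_mul_of_nonneg_right hn (by positivity)) ?_
    have e1 : (2 * ((2 * ((k : ℝ) + 1)) ^ 2 * ΔB)) ^ (k + 1)
        = (8 * (l : ℝ) ^ 2 * K ^ 2) ^ (k + 1) * (ΔB / (4 * K ^ 2)) ^ (k + 1) := by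
      rw [← mul_pow]
      congr 1
      rw [hl]
      push_cast
      field_simp
      ring
    rw [e1, ← mul_assoc, mul_div_assoc, mul_pow (T : ℝ) (ΔB / (4 * K ^ 2) : ℝ)]
    refine mul_lt_mul_of_pos_right ?_ (by positivity)
    exact_mod_cast hT'
  -- Failure of balance gives T ≤ ΔA ≤ 15552 * K ^ 3 * s, so s absorbs the number of colour sets; l
  -- ≥ 2 makes the inequality strict.
  · have h1 : 15552 * K ^ 3 * (288 * K * l) ^ l ≤ 15552 * K ^ 3 * s := by
      refine (hT.trans hTA).trans (Nat.le_of_mul_le_mul_right ?_ hB0)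
      calc ΔA * ΔB ≤ 15552 * K ^ 3 * ΔC := hbal
        _ ≤ 15552 * K ^ 3 * (s * ΔB) := Nat.mul_le_mul_left _ hs
        _ = _ := by ring
    have h2 := Nat.le_of_mul_le_mul_left h1 (by positivity)
    have h3 : 0 < (288 * K * l) ^ l := by positivity
    have h4 : 2 * s ≤ l * s := Nat.mul_le_mul_right _ (by omega)
    omega

theorem exists_isTwoRegular_of_almostRegular {pA : ι → α} {pB : ι → β} {pC : ι → γ}
    {E : Finset ι} {ΔA ΔB ΔC K n k T : ℕ} (hlin : IsLinearOn pA pB pC E) (hE0 : E.Nonempty)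
    (hA : IsAlmostRegular pA E ΔA K) (hB : IsAlmostRegular pB E ΔB K)
    (hC : IsAlmostRegular pC E ΔC K) (hnA : Fintype.card α ≤ n) (hnB : Fintype.card β ≤ n)
    (hnC : Fintype.card γ ≤ n) (hK : 0 < K) (hTA : T ≤ ΔA) (hTB : T ≤ ΔB) (hTC : T ≤ ΔC)
    (hT : 15552 * K ^ 3 * (288 * K * (2 * (k + 1))) ^ (2 * (k + 1)) ≤ T)
    (hT' : 2 * n * (8 * (2 * (k + 1)) ^ 2 * K ^ 2) ^ (k + 1) < T ^ (k + 1)) :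
    ∃ S ⊆ E, IsTwoRegular pA pB pC S := by
  -- The part of largest degree must come last. Of the eight patterns two are cyclic, possible only
  -- when all degrees agree, and any order serves there.
  rcases le_total ΔA ΔB with h1 | h1 <;> rcases le_total ΔB ΔC with h2 | h2 <;>
    rcases le_total ΔA ΔC with h3 | h3
  · exact exists_isTwoRegular_of_almostRegular_of_le hlin hE0 hA hB hC hnA hnB hK hTA h1 h2 hT hT'
  · exact exists_isTwoRegular_of_almostRegular_of_le hlin hE0 hA hB hC hnA hnB hK hTA h1 h2 hT hT'
  · obtain ⟨S, hS, h⟩ := exists_isTwoRegular_of_almostRegular_of_le hlin.swap_bc hE0 hA hC hB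
      hnA hnC hK hTA h3 h2 hT hT'
    exact ⟨S, hS, h.swap_bc⟩
  · obtain ⟨S, hS, h⟩ := exists_isTwoRegular_of_almostRegular_of_le hlin.swap_bc.swap_ab hE0 hC hA
      hB hnC hnA hK hTC h3 h1 hT hT'
    exact ⟨S, hS, h.swap_ab.swap_bc⟩
  · obtain ⟨S, hS, h⟩ := exists_isTwoRegular_of_almostRegular_of_le hlin.swap_ab hE0 hB hA hC
      hnB hnA hK hTB h1 h3 hT hT'
    exact ⟨S, hS, h.swap_ab⟩
  · obtain ⟨S, hS, h⟩ := exists_isTwoRegular_of_almostRegular_of_le hlin.swap_ab.swap_bc hE0 hB hC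
      hA hnB hnC hK hTB h2 h3 hT hT'
    exact ⟨S, hS, h.swap_bc.swap_ab⟩
  · obtain ⟨S, hS, h⟩ := exists_isTwoRegular_of_almostRegular_of_le
      hlin.swap_bc.swap_ab.swap_bc hE0 hC hB hA hnC hnB hK hTC h2 h1 hT hT'
    exact ⟨S, hS, h.swap_bc.swap_ab.swap_bc⟩
  · obtain ⟨S, hS, h⟩ := exists_isTwoRegular_of_almostRegular_of_le
      hlin.swap_bc.swap_ab.swap_bc hE0 hC hB hA hnC hnB hK hTC h2 h1 hT hT'
    exact ⟨S, hS, h.swap_bc.swap_ab.swap_bc⟩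

/-- Restricting to edges whose vertices have degree about `2 ^ i` makes a part almost regular. -/
theorem isAlmostRegular_of_log_deg_eq {δ : Type*} [DecidableEq δ] {p : ι → δ} {E F : Finset ι}
    (hFE : F ⊆ E) {i P : ℕ}
    (hi : ∀ e ∈ F, Nat.log 2 (E.filter fun f => p f = p e).card = i) (hP : E.card ≤ P * F.card) :
    IsAlmostRegular p F (2 ^ (i + 1)) (2 * P) := by
  have hpos : ∀ e ∈ F, (E.filter fun f => p f = p e).card ≠ 0 := fun e he =>
    by
    have : e ∈ E.filter fun f => p f = p e := Finset.mem_filter.2 ⟨hFE he, rfl⟩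
    exact (Finset.card_pos.2 ⟨e, this⟩).ne'
  constructor
  · intro d
    rcases (F.filter fun e => p e = d).eq_empty_or_nonempty with h | ⟨e, he⟩
    · rw [h]; simp
    · obtain ⟨heF, rfl⟩ := Finset.mem_filter.1 he
      refine (Finset.card_le_card (Finset.filter_subset_filter _ hFE)).trans ?_
      rw [← hi e heF]
      exact (Nat.lt_pow_succ_log_self one_lt_two _).le
  -- The lower bound 2 ^ i is for degrees in E, not in F; the factor P pays for the return to F.
  · have h1 : (F.image p).card * 2 ^ i ≤ E.card := by
      have h2 : (F.image p).card * 2 ^ i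
          ≤ ∑ d ∈ F.image p, (E.filter fun e => p e = d).card := by
        rw [← smul_eq_mul]
        refine Finset.card_nsmul_le_sum _ _ _ fun d hd => ?_
        obtain ⟨e, he, rfl⟩ := Finset.mem_image.1 hd
        rw [← hi e he]
        exact Nat.pow_log_le_self 2 (hpos e he)
      rw [Finset.sum_card_fiberwise_eq_card_filter] at h2
      exact h2.trans (Finset.card_filter_le _ _)
    calc (F.image p).card * 2 ^ (i + 1) = 2 * ((F.image p).card * 2 ^ i) := by ring
      _ ≤ 2 * (P * F.card) := Nat.mul_le_mul_left _ (h1.trans hP)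
      _ = _ := by ring

theorem card_filter_le_of_injOn {δ ε : Type*} [DecidableEq δ] [Fintype ε] {p : ι → δ} {q : ι → ε}
    {E : Finset ι} {n : ℕ} (hn : Fintype.card ε ≤ n)
    (h : ∀ e ∈ E, ∀ f ∈ E, p e = p f → q e = q f → e = f) (d : δ) :
    (E.filter fun e => p e = d).card ≤ n := by
  classical
  refine le_trans ?_ hn
  rw [← Finset.card_univ]
  refine Finset.card_le_card_of_injOn q (fun _ _ => Finset.mem_coe.2 (Finset.mem_univ _))
    fun e he f hf hq => ?_
  obtain ⟨he, h1⟩ := Finset.mem_filter.1 (Finset.mem_coe.1 he)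
  obtain ⟨hf, h2⟩ := Finset.mem_filter.1 (Finset.mem_coe.1 hf)
  exact h e he f hf (h1.trans h2.symm) hq

/-- Every linear tripartite hypergraph has a large almost regular subhypergraph. -/
theorem exists_almostRegular {pA : ι → α} {pB : ι → β} {pC : ι → γ} {E : Finset ι} {n : ℕ}
    (hlin : IsLinearOn pA pB pC E) (hnA : Fintype.card α ≤ n) (hnB : Fintype.card β ≤ n) :
    ∃ F ⊆ E, ∃ ΔA ΔB ΔC, E.card ≤ (Nat.log 2 n + 1) ^ 3 * F.card ∧
      IsAlmostRegular pA F ΔA (2 * (Nat.log 2 n + 1) ^ 3) ∧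
      IsAlmostRegular pB F ΔB (2 * (Nat.log 2 n + 1) ^ 3) ∧
      IsAlmostRegular pC F ΔC (2 * (Nat.log 2 n + 1) ^ 3) := by
  set L := Nat.log 2 n + 1 with hL
  set dA : ι → ℕ := fun e => Nat.log 2 (E.filter fun f => pA f = pA e).card with hdA
  set dB : ι → ℕ := fun e => Nat.log 2 (E.filter fun f => pB f = pB e).card with hdB
  set dC : ι → ℕ := fun e => Nat.log 2 (E.filter fun f => pC f = pC e).card with hdC
  have hlt : ∀ {m : ℕ}, m ≤ n → Nat.log 2 m < L := fun h =>
    Nat.lt_succ_of_le (Nat.log_mono_right h)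
  set t := Finset.range L ×ˢ (Finset.range L ×ˢ Finset.range L) with ht
  have htc : t.card = L ^ 3 := by
    rw [ht, Finset.card_product, Finset.card_product, Finset.card_range]; ring
  have hmaps : ∀ e ∈ E, (dA e, dB e, dC e) ∈ t := by
    intro e _
    simp only [ht, Finset.mem_product, Finset.mem_range]
    exact ⟨hlt (card_filter_le_of_injOn hnB hlin.ab _),
      hlt (card_filter_le_of_injOn hnA hlin.swap_ab.ab _),
      hlt (card_filter_le_of_injOn hnA hlin.swap_bc.swap_ab.ab _)⟩
  have htne : t.Nonempty := by
    rw [← Finset.card_pos, htc]; positivity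
  obtain ⟨x, -, hx⟩ := Finset.exists_max_image t
    (fun x => (E.filter fun e => (dA e, dB e, dC e) = x).card) htne
  have hcard := Finset.card_le_mul_card_image_of_maps_to hmaps _ hx
  rw [htc, mul_comm] at hcard
  refine ⟨_, Finset.filter_subset _ _, 2 ^ (x.1 + 1), 2 ^ (x.2.1 + 1), 2 ^ (x.2.2 + 1), hcard,
    isAlmostRegular_of_log_deg_eq (Finset.filter_subset _ _) (fun e he => ?_) hcard,
    isAlmostRegular_of_log_deg_eq (Finset.filter_subset _ _) (fun e he => ?_) hcard,
    isAlmostRegular_of_log_deg_eq (Finset.filter_subset _ _) (fun e he => ?_) hcard⟩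
  · rw [← (Finset.mem_filter.1 he).2]
  · rw [← (Finset.mem_filter.1 he).2]
  · rw [← (Finset.mem_filter.1 he).2]

/-- Used in reverse: at least n * T edges force Δ ≥ T in every part. -/
theorem IsAlmostRegular.card_le {δ : Type*} [DecidableEq δ] [Fintype δ] {p : ι → δ} {E : Finset ι}
    {Δ K n : ℕ} (h : IsAlmostRegular p E Δ K) (hn : Fintype.card δ ≤ n) : E.card ≤ n * Δ := by
  have := card_filter_mem_le h.deg_le Finset.univ
  simp only [Finset.mem_univ, Finset.filter_true] at this
  exact this.trans (Nat.mul_le_mul_right _ hn)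

/-- A linear tripartite hypergraph with many edges contains a two-regular subhypergraph. -/
theorem exists_isTwoRegular {pA : ι → α} {pB : ι → β} {pC : ι → γ} {E : Finset ι} {n k T K : ℕ}
    (hlin : IsLinearOn pA pB pC E) (hnA : Fintype.card α ≤ n) (hnB : Fintype.card β ≤ n)
    (hnC : Fintype.card γ ≤ n) (hn : 0 < n) (hK : K = 2 * (Nat.log 2 n + 1) ^ 3)
    (hT : 15552 * K ^ 3 * (288 * K * (2 * (k + 1))) ^ (2 * (k + 1)) ≤ T)
    (hT' : 2 * n * (8 * (2 * (k + 1)) ^ 2 * K ^ 2) ^ (k + 1) < T ^ (k + 1))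
    (hE : n * K * T ≤ E.card) : ∃ S ⊆ E, IsTwoRegular pA pB pC S := by
  obtain ⟨F, hFE, ΔA, ΔB, ΔC, hc, hA, hB, hC⟩ := exists_almostRegular hlin hnA hnB
  rw [← hK] at hA hB hC
  have hL : 0 < (Nat.log 2 n + 1) ^ 3 := by positivity
  have hK0 : 0 < K := by omega
  have hT0 : 0 < T := lt_of_lt_of_le (by positivity) hT
  have hF : n * T ≤ F.card := by
    refine Nat.le_of_mul_le_mul_left ?_ hL
    refine le_trans ?_ hc
    refine le_trans ?_ hE
    rw [hK]
    calc (Nat.log 2 n + 1) ^ 3 * (n * T) ≤ 2 * ((Nat.log 2 n + 1) ^ 3 * (n * T)) := by omega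
      _ = _ := by ring
  have hF0 : F.Nonempty := Finset.card_pos.1 (lt_of_lt_of_le (by positivity) hF)
  have hTle : ∀ {Δ : ℕ}, F.card ≤ n * Δ → T ≤ Δ := fun h =>
    Nat.le_of_mul_le_mul_left (hF.trans h) hn
  obtain ⟨S, hS, h⟩ := exists_isTwoRegular_of_almostRegular (hlin.mono hFE) hF0 hA hB hC hnA hnB
    hnC hK0 (hTle (hA.card_le hnA)) (hTle (hB.card_le hnB)) (hTle (hC.card_le hnC)) hT hT'
  exact ⟨S, hS.trans hFE, h⟩

end Tripartite

/-! ### Random tripartition -/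

namespace Tripartite

variable {V : Type*} [Fintype V] [DecidableEq V]

/-- Overwriting the values at x, y, z sends every colouring to a prescribed one, and only the 27
lost triples of values can be identified. -/
theorem three_pow_card_le {x y z : V} (hxy : x ≠ y) (hxz : x ≠ z) (hyz : y ≠ z) :
    3 ^ Fintype.card V
      ≤ 27 * (Finset.univ.filter fun φ : V → Fin 3 => φ x = 0 ∧ φ y = 1 ∧ φ z = 2).card := by
  have h := Finset.card_le_mul_card_image_of_maps_to
    (s := (Finset.univ : Finset (V → Fin 3)))
    (t := Finset.univ.filter fun φ : V → Fin 3 => φ x = 0 ∧ φ y = 1 ∧ φ z = 2)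
    (f := fun φ => Function.update (Function.update (Function.update φ x 0) y 1) z 2)
    (fun φ _ => by simp [Function.update, hxy, hxz, hyz]) 27 (fun ψ _ => ?_)
  · simpa using h
  · have h27 : (Finset.univ : Finset (Fin 3 × Fin 3 × Fin 3)).card = 27 := rfl
    rw [← h27]
    refine Finset.card_le_card_of_injOn (fun φ => (φ x, φ y, φ z))
      (fun _ _ => Finset.mem_coe.2 (Finset.mem_univ _)) fun φ hφ φ' hφ' heq => ?_
    have h1 := (Finset.mem_filter.1 (Finset.mem_coe.1 hφ)).2.trans
      (Finset.mem_filter.1 (Finset.mem_coe.1 hφ')).2.symm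
    simp only [Prod.mk.injEq] at heq
    funext v
    have h2 := congrFun h1 v
    by_cases hz : v = z
    · rw [hz]; exact heq.2.2
    by_cases hy : v = y
    · rw [hy]; exact heq.2.1
    by_cases hx : v = x
    · rw [hx]; exact heq.1
    simpa [Function.update, hx, hy, hz] using h2

/-- Some colouring of the vertices makes a positive proportion of the triples tripartite. -/
theorem exists_tripartition {ι : Type*} (E : Finset ι) (x y z : ι → V)
    (hxy : ∀ e ∈ E, x e ≠ y e) (hxz : ∀ e ∈ E, x e ≠ z e) (hyz : ∀ e ∈ E, y e ≠ z e) :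
    ∃ φ : V → Fin 3,
      E.card ≤ 27 * (E.filter fun e => φ (x e) = 0 ∧ φ (y e) = 1 ∧ φ (z e) = 2).card := by
  by_contra! hno
  have h1 : ∑ φ : V → Fin 3,
      27 * (E.filter fun e => φ (x e) = 0 ∧ φ (y e) = 1 ∧ φ (z e) = 2).card
      < ∑ _φ : V → Fin 3, E.card :=
    Finset.sum_lt_sum_of_nonempty Finset.univ_nonempty fun φ _ => hno φ
  have h2 : ∑ φ : V → Fin 3, (E.filter fun e => φ (x e) = 0 ∧ φ (y e) = 1 ∧ φ (z e) = 2).card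
      = ∑ e ∈ E,
        (Finset.univ.filter fun φ : V → Fin 3 => φ (x e) = 0 ∧ φ (y e) = 1 ∧ φ (z e) = 2).card :=
    Finset.sum_card_bipartiteAbove_eq_sum_card_bipartiteBelow _
  rw [← Finset.mul_sum, h2, Finset.mul_sum] at h1
  refine absurd h1 (not_lt.2 ?_)
  have h3 : (Fintype.card (V → Fin 3)) = 3 ^ Fintype.card V := by simp
  rw [Finset.sum_const, Finset.card_univ, h3, smul_eq_mul, mul_comm, ← smul_eq_mul]
  exact Finset.card_nsmul_le_sum _ _ _ fun e he =>
    three_pow_card_le (hxy e he) (hxz e he) (hyz e he)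

end Tripartite

/-! ### Transfer to hypergraphs -/

namespace Hypergraph

open Tripartite

theorem containsRegular_two_of_le_ncard {α : Type*} {H : Hypergraph α} (hu : H.IsUniform 3)
    (hlin : H.IsLinear) {n k T K : ℕ} (hcard : H.vertexSet.ncard = n) (hn : 0 < n)
    (hK : K = 2 * (Nat.log 2 n + 1) ^ 3)
    (hT : 15552 * K ^ 3 * (288 * K * (2 * (k + 1))) ^ (2 * (k + 1)) ≤ T)
    (hT' : 2 * n * (8 * (2 * (k + 1)) ^ 2 * K ^ 2) ^ (k + 1) < T ^ (k + 1))
    (hE : 27 * (n * K * T) ≤ H.edgeSet.ncard) : H.ContainsRegular 2 := by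
  classical
  have hfin : H.vertexSet.Finite := Set.finite_of_ncard_pos (by omega)
  have hne : H.vertexSet.Nonempty := Set.nonempty_of_ncard_ne_zero (by omega)
  have hEfin : H.edgeSet.Finite :=
    hfin.finite_subsets.subset fun e he => H.subset_vertexSet_of_mem_edgeSet he
  have : Fintype H.vertexSet := hfin.fintype
  have : Nonempty H.vertexSet := hne.to_subtype
  have hVn : Fintype.card H.vertexSet ≤ n := by
    rw [← hcard, ← Nat.card_coe_set_eq, Nat.card_eq_fintype_card]
  have hex : ∀ e : Set α, ∃ x y z : H.vertexSet, e ∈ H.edgeSet →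
      (x ≠ y ∧ x ≠ z ∧ y ≠ z ∧ ∀ v : α, v ∈ e ↔ v = x ∨ v = y ∨ v = z) := by
    intro e
    by_cases he : e ∈ H.edgeSet
    · obtain ⟨x, y, z, hxy, hxz, hyz, rfl⟩ := Set.ncard_eq_three.1 (hu e he)
      have hs := H.subset_vertexSet_of_mem_edgeSet he
      exact ⟨⟨x, hs (by simp)⟩, ⟨y, hs (by simp)⟩, ⟨z, hs (by simp)⟩, fun _ =>
        ⟨by simpa using hxy, by simpa using hxz, by simpa using hyz, fun v => by simp⟩⟩
    · obtain ⟨v⟩ : Nonempty H.vertexSet := hne.to_subtype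
      exact ⟨v, v, v, fun h => absurd h he⟩
  choose x y z hxyz using hex
  set E := hEfin.toFinset with hEdef
  have hmem : ∀ e ∈ E, e ∈ H.edgeSet := fun e he => hEfin.mem_toFinset.1 he
  obtain ⟨φ, hφ⟩ := exists_tripartition E x y z (fun e he => (hxyz e (hmem e he)).1)
    (fun e he => (hxyz e (hmem e he)).2.1) (fun e he => (hxyz e (hmem e he)).2.2.1)
  set F := E.filter fun e => φ (x e) = 0 ∧ φ (y e) = 1 ∧ φ (z e) = 2 with hF
  have hEc : E.card = H.edgeSet.ncard := (Set.ncard_eq_toFinset_card _ hEfin).symm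
  have hFE : ∀ e ∈ F, e ∈ H.edgeSet := fun e he => hmem e (Finset.mem_filter.1 he).1
  have hsub : ∀ e ∈ F, ∀ f ∈ F, ∀ u v : H.vertexSet, u ≠ v → (u : α) ∈ e → (v : α) ∈ e →
      (u : α) ∈ f → (v : α) ∈ f → e = f := by
    intro e he f hf u v huv hue hve huf hvf
    by_contra hef
    exact huv (Subtype.ext (hlin e (hFE e he) f (hFE f hf) hef ⟨hue, huf⟩ ⟨hve, hvf⟩))
  have hx : ∀ e ∈ F, (x e : α) ∈ e := fun e he =>
    ((hxyz e (hFE e he)).2.2.2 _).2 (Or.inl rfl)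
  have hy : ∀ e ∈ F, (y e : α) ∈ e := fun e he =>
    ((hxyz e (hFE e he)).2.2.2 _).2 (Or.inr (Or.inl rfl))
  have hz : ∀ e ∈ F, (z e : α) ∈ e := fun e he =>
    ((hxyz e (hFE e he)).2.2.2 _).2 (Or.inr (Or.inr rfl))
  have hlinF : IsLinearOn x y z F :=
    ⟨fun e he f hf h1 h2 => hsub e he f hf _ _ (hxyz e (hFE e he)).1 (hx e he) (hy e he)
        (h1 ▸ hx f hf) (h2 ▸ hy f hf),
      fun e he f hf h1 h2 => hsub e he f hf _ _ (hxyz e (hFE e he)).2.2.1 (hy e he) (hz e he)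
        (h1 ▸ hy f hf) (h2 ▸ hz f hf),
      fun e he f hf h1 h2 => hsub e he f hf _ _ (hxyz e (hFE e he)).2.1 (hx e he) (hz e he)
        (h1 ▸ hx f hf) (h2 ▸ hz f hf)⟩
  obtain ⟨S, hSF, hS⟩ := exists_isTwoRegular hlinF hVn hVn hVn hn hK hT hT' (by omega)
  -- The colouring φ keeps the three coordinates apart, so the edges at a vertex are exactly those
  -- having it as their coordinate of the same kind.
  have hdeg : ∀ e ∈ S, ∀ v : α, v ∈ e → {f | f ∈ S ∧ v ∈ f}.encard = 2 := by
    intro e he v hve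
    have hmemiff : ∀ f ∈ S, ∀ w : H.vertexSet, (w : α) ∈ f ↔ w = x f ∨ w = y f ∨ w = z f := by
      intro f hf w
      rw [(hxyz f (hFE f (hSF hf))).2.2.2]
      simp only [Subtype.ext_iff]
    have hφF : ∀ f ∈ S, φ (x f) = 0 ∧ φ (y f) = 1 ∧ φ (z f) = 2 := fun f hf =>
      (Finset.mem_filter.1 (hSF hf)).2
    have hcase : ∀ p : Set α → H.vertexSet,
        (∀ f ∈ S, (p e : α) ∈ f ↔ p f = p e) → (S.filter fun f => p f = p e).card = 2 →
        {f | f ∈ S ∧ (p e : α) ∈ f}.encard = 2 := by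
      intro p hp h2
      have : {f | f ∈ S ∧ (p e : α) ∈ f} = ((S.filter fun f => p f = p e : Finset (Set α))) := by
        ext f
        simp only [Set.mem_ofPred_eq, Finset.coe_filter]
        exact and_congr_right fun hf => hp f hf
      rw [this, Set.encard_coe_eq_coe_finsetCard, h2]
      rfl
    have h0 := hφF e he
    rcases ((hxyz e (hFE e (hSF he))).2.2.2 v).1 hve with rfl | rfl | rfl
    · refine hcase x (fun f hf => ?_) (hS.degA e he)
      rw [hmemiff f hf]
      have h1 := hφF f hf
      constructor
      · rintro (h | h | h)
        · exact h.symm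
        · rw [h, h1.2.1] at h0; exact absurd h0.1 (by decide)
        · rw [h, h1.2.2] at h0; exact absurd h0.1 (by decide)
      · exact fun h => Or.inl h.symm
    · refine hcase y (fun f hf => ?_) (hS.degB e he)
      rw [hmemiff f hf]
      have h1 := hφF f hf
      constructor
      · rintro (h | h | h)
        · rw [h, h1.1] at h0; exact absurd h0.2.1 (by decide)
        · exact h.symm
        · rw [h, h1.2.2] at h0; exact absurd h0.2.1 (by decide)
      · exact fun h => Or.inr (Or.inl h.symm)
    · refine hcase z (fun f hf => ?_) (hS.degC e he)
      rw [hmemiff f hf]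
      have h1 := hφF f hf
      constructor
      · rintro (h | h | h)
        · rw [h, h1.1] at h0; exact absurd h0.2.2 (by decide)
        · rw [h, h1.2.1] at h0; exact absurd h0.2.2 (by decide)
        · exact h.symm
      · exact fun h => Or.inr (Or.inr h.symm)
  -- Only covered vertices are kept, since isolated ones would have degree zero.
  refine ⟨⟨⋃ e ∈ S, e, S, fun e he => Set.subset_biUnion_of_mem (u := fun e : Set α => e) he⟩,
    ⟨?_, fun e he => hFE e (hSF he)⟩, ?_, ?_⟩
  · exact Set.iUnion₂_subset fun e he => H.subset_vertexSet_of_mem_edgeSet (hFE e (hSF he))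
  · obtain ⟨e, he⟩ := hS.nonempty
    exact ⟨x e, Set.mem_biUnion (t := fun e : Set α => e) he (hx e (hSF he))⟩
  · intro v hv
    obtain ⟨e, he, hve⟩ := Set.mem_iUnion₂.1 hv
    exact hdeg e he v hve

/-- A linear `3`-uniform hypergraph has at most `n ^ 2` edges. -/
theorem ncard_edgeSet_le_sq {α : Type*} {H : Hypergraph α} (hu : H.IsUniform 3)
    (hlin : H.IsLinear) (hfin : H.vertexSet.Finite) :
    H.edgeSet.ncard ≤ H.vertexSet.ncard ^ 2 := by
  rcases H.edgeSet.eq_empty_or_nonempty with h0 | ⟨e₀, he₀⟩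
  · simp [h0]
  have hα : Nonempty α := by
    obtain ⟨x, -⟩ := Set.ncard_eq_three.1 (hu e₀ he₀)
    exact ⟨x⟩
  have hex : ∀ e : Set α, ∃ p : α × α, e ∈ H.edgeSet → p.1 ≠ p.2 ∧ p.1 ∈ e ∧ p.2 ∈ e := by
    intro e
    by_cases he : e ∈ H.edgeSet
    · obtain ⟨x, y, z, hxy, -, -, rfl⟩ := Set.ncard_eq_three.1 (hu e he)
      exact ⟨(x, y), fun _ => ⟨hxy, by simp, by simp⟩⟩
    · exact ⟨(hα.some, hα.some), fun h => absurd h he⟩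
  choose p hp using hex
  rw [sq, ← Set.ncard_prod]
  refine Set.ncard_le_ncard_of_injOn p (fun e he => ?_) (fun e he f hf hef => ?_) (hfin.prod hfin)
  · have := H.subset_vertexSet_of_mem_edgeSet he
    exact ⟨this (hp e he).2.1, this (hp e he).2.2⟩
  · by_contra hne
    exact (hp e he).1 (hlin e he f hf hne ⟨(hp e he).2.1, hef ▸ (hp f hf).2.1⟩
      ⟨(hp e he).2.2, hef ▸ (hp f hf).2.2⟩)

end Hypergraph

/-! ### Choice of parameters and asymptotics -/

namespace Hypergraph

/-- Both bounds come from log t ≥ 1 - 1/t, at t = 3/e and t = log n. They make log log n positive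
from n = 3 on. -/
theorem log_log_bounds {n : ℕ} (hn : 3 ≤ n) :
    1.09 ≤ Real.log n ∧ 0.08 ≤ Real.log (Real.log n) := by
  have h3 : (1.09 : ℝ) ≤ Real.log n := by
    have h1 : Real.log 3 ≤ Real.log n := Real.log_le_log (by norm_num) (by exact_mod_cast hn)
    have h2 := Real.one_sub_inv_le_log_of_pos (x := 3 / Real.exp 1) (by positivity)
    rw [Real.log_div (by norm_num) (Real.exp_pos _).ne', Real.log_exp, inv_div] at h2
    have := Real.exp_one_lt_d9
    linarith
  refine ⟨h3, ?_⟩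
  have h1 := Real.one_sub_inv_le_log_of_pos (x := Real.log n) (by linarith)
  have h2 : (Real.log n)⁻¹ ≤ (1.09)⁻¹ := inv_anti₀ (by norm_num) h3
  norm_num at h2 ⊢
  linarith

/-- The parameters `k`, `T` needed to find a `2`-regular subhypergraph. -/
theorem exists_parameters {n : ℕ} (hn : 3 ≤ n) {x y s : ℝ} (hx : x = Real.log n)
    (hy : y = Real.log x) (hs : s = Real.sqrt (x * y)) (hlarge : 10000 * y ≤ x) {K : ℕ}
    (hK : K = 2 * (Nat.log 2 n + 1) ^ 3) :
    ∃ k T : ℕ, 15552 * K ^ 3 * (288 * K * (2 * (k + 1))) ^ (2 * (k + 1)) ≤ T ∧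
      2 * n * (8 * (2 * (k + 1)) ^ 2 * K ^ 2) ^ (k + 1) < T ^ (k + 1) ∧
      (27 * (n * K * T) : ℝ) ≤ n * Real.exp (100 * s) := by
  obtain ⟨hx1, hy1⟩ := log_log_bounds hn
  rw [← hx] at hx1 hy1
  rw [← hy] at hy1
  have hn0 : (0 : ℝ) < n := by
    have : 0 < n := by omega
    exact_mod_cast this
  have hx800 : 800 ≤ x := by linarith
  have hx0 : 0 < x := by linarith
  have hexp : ∀ j : ℕ, x ^ j = Real.exp (j * y) := by
    intro j
    rw [Real.exp_nat_mul, hy, Real.exp_log hx0]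
  have hy2 : 1 ≤ y := by
    rw [hy, Real.le_log_iff_exp_le hx0]
    have := Real.exp_one_lt_d9
    linarith
  have hs2 : s ^ 2 = x * y := by rw [hs, Real.sq_sqrt (by positivity)]
  have hs0 : 0 < s := by rw [hs]; exact Real.sqrt_pos.2 (by positivity)
  have hsy : 100 * y ≤ s := by nlinarith
  have hsx : s ≤ x := by nlinarith
  -- This k balances the two constraints: (k + 1) * y ≤ 2 * s controls powers of log n, and s * (k +
  -- 1) ≥ x lets T ^ (k + 1) exceed n.
  set k := ⌈s / y⌉₊ with hk
  have hk1 : s / y ≤ k := Nat.le_ceil _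
  have hk2 : (k : ℝ) < s / y + 1 := Nat.ceil_lt_add_one (by positivity)
  have hky : s ≤ k * y := by rwa [div_le_iff₀ (by linarith)] at hk1
  have hky2 : (k + 1) * y ≤ 2 * s := by
    have h1 : (k : ℝ) * y < (s / y + 1) * y := mul_lt_mul_of_pos_right hk2 (by linarith)
    rw [add_mul, div_mul_cancel₀ _ (by linarith : y ≠ 0)] at h1
    linarith
  have hkx : x ≤ s * (k + 1) := by
    have h1 : s * s ≤ s * (k * y) := mul_le_mul_of_nonneg_left hky hs0.le
    have h2 : x * y ≤ (s * k) * y := by nlinarith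
    have h3 := le_of_mul_le_mul_right h2 (by linarith)
    linarith
  have hl : ((2 * (k + 1) : ℕ) : ℝ) ≤ x ^ 2 := by
    have : s / y ≤ x := (div_le_self hs0.le hy2).trans hsx
    push_cast
    nlinarith
  have hKx : (K : ℝ) ≤ x ^ 4 := by
    have h1 : (Nat.log 2 n : ℝ) ≤ 2 * x := by
      have h2 : ((2 ^ Nat.log 2 n : ℕ) : ℝ) ≤ n := by
        exact_mod_cast Nat.pow_log_le_self 2 (by omega : n ≠ 0)
      have h3 := Real.log_le_log (by positivity) h2
      push_cast at h3
      rw [Real.log_pow, ← hx] at h3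
      have := Real.log_two_gt_d9
      have h0 : (0 : ℝ) ≤ Nat.log 2 n := Nat.cast_nonneg _
      nlinarith
    have h2 : (Nat.log 2 n : ℝ) + 1 ≤ 3 * x := by linarith
    rw [hK]
    push_cast
    calc 2 * ((Nat.log 2 n : ℝ) + 1) ^ 3 ≤ 2 * (3 * x) ^ 3 := by gcongr
      _ = 54 * x ^ 3 := by ring
      _ ≤ x * x ^ 3 := by gcongr; linarith
      _ = x ^ 4 := by ring
  have hT1 : Real.exp (42 * s) ≤ (⌈Real.exp (42 * s)⌉₊ : ℝ) := Nat.le_ceil _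
  have hT2 : (⌈Real.exp (42 * s)⌉₊ : ℝ) ≤ x * Real.exp (42 * s) := by
    have h1 := (Nat.ceil_lt_add_one (Real.exp_pos (42 * s)).le).le
    have h2 : 1 ≤ Real.exp (42 * s) := Real.one_le_exp (by positivity)
    nlinarith
  refine ⟨k, ⌈Real.exp (42 * s)⌉₊, ?_, ?_, ?_⟩
  · have : (((15552 * K ^ 3 * (288 * K * (2 * (k + 1))) ^ (2 * (k + 1)) : ℕ)) : ℝ)
        ≤ (⌈Real.exp (42 * s)⌉₊ : ℝ) := by
      refine le_trans ?_ hT1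
      rw [Nat.cast_mul, Nat.cast_mul, Nat.cast_pow, Nat.cast_pow, Nat.cast_mul, Nat.cast_mul]
      calc ((15552 : ℕ) : ℝ) * (K : ℝ) ^ 3
            * (((288 : ℕ) : ℝ) * K * ((2 * (k + 1) : ℕ) : ℝ)) ^ (2 * (k + 1))
          ≤ x ^ 2 * (x ^ 4) ^ 3 * (x * x ^ 4 * x ^ 2) ^ (2 * (k + 1)) := by
            gcongr
            · push_cast; nlinarith
            · push_cast; linarith
        _ = x ^ (14 + 14 * (k + 1)) := by ring
        -- Here 42 = 14 + 28, from y ≤ s and (k + 1) * y ≤ 2 * s.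
        _ ≤ Real.exp (42 * s) := by
            rw [hexp]
            refine Real.exp_le_exp.2 ?_
            push_cast
            nlinarith
    exact_mod_cast this
  · have : ((2 * n * (8 * (2 * (k + 1)) ^ 2 * K ^ 2) ^ (k + 1) : ℕ) : ℝ)
        < ((⌈Real.exp (42 * s)⌉₊ ^ (k + 1) : ℕ) : ℝ) := by
      rw [Nat.cast_pow (⌈Real.exp (42 * s)⌉₊)]
      refine lt_of_lt_of_le ?_ (pow_le_pow_left₀ (Real.exp_pos _).le hT1 _)
      rw [Nat.cast_mul, Nat.cast_mul, Nat.cast_pow, Nat.cast_mul, Nat.cast_mul, Nat.cast_pow,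
        Nat.cast_pow]
      have hnx : (n : ℝ) = Real.exp x := by rw [hx, Real.exp_log hn0]
      calc ((2 : ℕ) : ℝ) * n
            * (((8 : ℕ) : ℝ) * ((2 * (k + 1) : ℕ) : ℝ) ^ 2 * (K : ℝ) ^ 2) ^ (k + 1)
          ≤ x * Real.exp x * (x * (x ^ 2) ^ 2 * (x ^ 4) ^ 2) ^ (k + 1) := by
            rw [hnx]
            gcongr
            · push_cast; linarith
            · push_cast; linarith
        _ = Real.exp x * x ^ (1 + 13 * (k + 1)) := by ring
        _ < Real.exp (42 * s) ^ (k + 1) := by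
            rw [hexp, ← Real.exp_add, ← Real.exp_nat_mul]
            refine Real.exp_lt_exp.2 ?_
            push_cast
            have hk0 : (0 : ℝ) ≤ k := Nat.cast_nonneg _
            have h1 : y * (k + 1) ≤ s * (k + 1) := by gcongr; linarith
            have h2 : 0 < s * (k + 1) := by positivity
            nlinarith
    exact_mod_cast this
  · calc (27 * (n * K * ⌈Real.exp (42 * s)⌉₊) : ℝ)
        ≤ x * (n * x ^ 4 * (x * Real.exp (42 * s))) := by
          gcongr
          linarith
      _ = n * (x ^ 6 * Real.exp (42 * s)) := by ring
      _ ≤ n * Real.exp (100 * s) := by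
          rw [hexp, ← Real.exp_add]
          gcongr
          push_cast
          linarith

/-- No separate treatment of small n is needed: linearity allows at most n² edges, so the edge
hypothesis itself forces 100 √(log n log log n) ≤ log n, the largeness required of the parameters.
-/
theorem containsRegular_two_of_exp_le {α : Type*} {H : Hypergraph α} (hu : H.IsUniform 3)
    (hlin : H.IsLinear) {n : ℕ} (hn : 3 ≤ n) (hcard : H.vertexSet.ncard = n)
    (hE : (n : ℝ) * Real.exp (100 * Real.sqrt (Real.log n * Real.log (Real.log n)))
      ≤ (H.edgeSet.ncard : ℝ)) : H.ContainsRegular 2 := by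
  obtain ⟨hx1, hy1⟩ := log_log_bounds hn
  have hn0 : (0 : ℝ) < n := by
    have : 0 < n := by omega
    exact_mod_cast this
  have hfin : H.vertexSet.Finite := Set.finite_of_ncard_pos (by omega)
  have hlarge : 10000 * Real.log (Real.log n) ≤ Real.log n := by
    have h1 : (H.edgeSet.ncard : ℝ) ≤ n * n := by
      have := ncard_edgeSet_le_sq hu hlin hfin
      rw [hcard, sq] at this
      exact_mod_cast this
    have h2 := le_of_mul_le_mul_left (hE.trans h1) hn0
    rw [← Real.le_log_iff_exp_le hn0] at h2
    have hs2 := Real.sq_sqrt (x := Real.log n * Real.log (Real.log n)) (by nlinarith)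
    have hs0 := Real.sqrt_nonneg (Real.log n * Real.log (Real.log n))
    have h3 : Real.log n * (10000 * Real.log (Real.log n)) ≤ Real.log n * Real.log n := by
      nlinarith
    exact le_of_mul_le_mul_left h3 (by linarith)
  obtain ⟨k, T, hT, hT', hb⟩ := exists_parameters hn rfl rfl rfl hlarge rfl
  refine containsRegular_two_of_le_ncard hu hlin hcard (by omega) rfl hT hT' ?_
  exact_mod_cast hb.trans hE

theorem maxEdges_le_exp {n : ℕ} (hn : 3 ≤ n) : (maxEdges n : ℝ)
    ≤ n * Real.exp (100 * Real.sqrt (Real.log n * Real.log (Real.log n))) := by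
  obtain ⟨H, hV, hu, hlin, hno, hc⟩ := (isGreatest_maxEdges n).1
  by_contra h
  refine hno (containsRegular_two_of_exp_le hu hlin hn ?_ ?_)
  · rw [hV, Set.ncard_univ, Nat.card_eq_fintype_card, Fintype.card_fin]
  · rw [hc]; exact (not_le.1 h).le

/-- Disjoint triples show that `f(n) ≥ ⌊n / 3⌋`. -/
theorem div_three_le_maxEdges (n : ℕ) : n / 3 ≤ maxEdges n := by
  refine (isGreatest_maxEdges n).2 ?_
  set B : ℕ → Set (Fin n) := fun i => {v | (v : ℕ) / 3 = i} with hB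
  have hmem : ∀ i v, v ∈ B i ↔ (v : ℕ) / 3 = i := fun i v => Iff.rfl
  refine ⟨⟨Set.univ, B '' (Finset.range (n / 3)), fun e _ => Set.subset_univ e⟩, rfl, ?_, ?_, ?_,
    ?_⟩
  · rintro _ ⟨i, hi, rfl⟩
    rw [Finset.mem_coe, Finset.mem_range] at hi
    rw [Set.ncard_eq_three]
    refine ⟨⟨3 * i, by omega⟩, ⟨3 * i + 1, by omega⟩, ⟨3 * i + 2, by omega⟩, by simp, by simp,
      by simp, ?_⟩
    ext v
    simp only [hmem, Set.mem_insert_iff, Set.mem_singleton_iff, Fin.ext_iff]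
    omega
  · rintro _ ⟨i, -, rfl⟩ _ ⟨j, -, rfl⟩ hij v ⟨hv, hv'⟩
    rw [hmem] at hv hv'
    exact absurd (by rw [← hv, ← hv']) hij
  · rintro ⟨L, ⟨-, hL⟩, ⟨v, hv⟩, hdeg⟩
    have h2 := hdeg v hv
    have h1 : L.degree v ≤ 1 := by
      rw [degree, Set.encard_le_one_iff]
      rintro e f ⟨he, hve⟩ ⟨hf, hvf⟩
      obtain ⟨i, -, rfl⟩ := hL he
      obtain ⟨j, -, rfl⟩ := hL hf
      rw [hmem] at hve hvf
      rw [← hve, ← hvf]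
    rw [h2] at h1
    exact absurd h1 (by decide)
  · show (B '' (Finset.range (n / 3))).ncard = n / 3
    rw [Set.InjOn.ncard_image, Set.ncard_coe_finset, Finset.card_range]
    intro i hi j hj hij
    rw [Finset.mem_coe, Finset.mem_range] at hi
    have : (⟨3 * i, by omega⟩ : Fin n) ∈ B j := by
      rw [← hij, hmem]
      simp
    rw [hmem] at this
    simpa using this

/-- Squeezed between -log 6 / log n, from disjoint triples, and 100 √(log log n / log n), from the
upper bound on f(n). -/
theorem tendsto_log_maxEdges :
    Tendsto (fun n : ℕ => Real.log (maxEdges n) / Real.log n - 1) atTop (𝓝 0) := by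
  have hlog : Tendsto (fun n : ℕ => Real.log n) atTop atTop :=
    Real.tendsto_log_atTop.comp tendsto_natCast_atTop_atTop
  have hlow : Tendsto (fun n : ℕ => -(Real.log 6 / Real.log n)) atTop (𝓝 0) := by
    have := (hlog.const_div_atTop (Real.log 6)).neg
    simpa using this
  have hupp : Tendsto (fun n : ℕ => 100 * Real.sqrt (Real.log (Real.log n) / Real.log n)) atTop
      (𝓝 0) := by
    have h1 : Tendsto (fun x : ℝ => Real.log x / x) atTop (𝓝 0) :=
      Real.isLittleO_log_id_atTop.tendsto_div_nhds_zero
    have h2 := ((h1.comp hlog).sqrt).const_mul 100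
    simpa using h2
  refine tendsto_of_tendsto_of_tendsto_of_le_of_le' hlow hupp ?_ ?_
  · filter_upwards [eventually_ge_atTop 3] with n hn
    obtain ⟨hx, -⟩ := log_log_bounds hn
    have hn0 : (0 : ℝ) < n := by
      have : 0 < n := by omega
      exact_mod_cast this
    -- The 6 in place of 3 absorbs the rounding in n / 3.
    have h1 : (n : ℝ) / 6 ≤ maxEdges n := by
      have h2 := div_three_le_maxEdges n
      have h3 : n ≤ 6 * maxEdges n := by omega
      rw [div_le_iff₀ (by norm_num), mul_comm]
      exact_mod_cast h3
    have h2 := Real.log_le_log (by positivity) h1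
    rw [Real.log_div hn0.ne' (by norm_num)] at h2
    have hx0 : 0 < Real.log n := by linarith
    have h3 : (Real.log n - Real.log 6) / Real.log n ≤ Real.log (maxEdges n) / Real.log n := by
      gcongr
    rw [sub_div, div_self hx0.ne'] at h3
    linarith
  · filter_upwards [eventually_ge_atTop 3] with n hn
    obtain ⟨hx, hy⟩ := log_log_bounds hn
    have hn0 : (0 : ℝ) < n := by
      have : 0 < n := by omega
      exact_mod_cast this
    have hm0 : (0 : ℝ) < maxEdges n := by
      have := div_three_le_maxEdges n
      have : 0 < maxEdges n := by omega
      exact_mod_cast this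
    have hx0 : 0 < Real.log n := by linarith
    have h1 := Real.log_le_log hm0 (maxEdges_le_exp hn)
    rw [Real.log_mul hn0.ne' (Real.exp_pos _).ne', Real.log_exp] at h1
    have h2 : Real.sqrt (Real.log (Real.log n) / Real.log n)
        = Real.sqrt (Real.log n * Real.log (Real.log n)) / Real.log n := by
      have e : Real.log (Real.log n) / Real.log n
          = Real.log n * Real.log (Real.log n) / Real.log n ^ 2 := by
        field_simp
      rw [e, Real.sqrt_div (by positivity), Real.sqrt_sq hx0.le]
    rw [h2, ← mul_div_assoc, sub_le_iff_le_add, div_le_iff₀ hx0, add_mul,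
      div_mul_cancel₀ _ hx0.ne']
    linarith

end Hypergraph

theorem theorem1p1 :
    (∃ C : ℝ, 0 < C ∧
      (∀ n : ℕ, 3 ≤ n →
        ∀ (α : Type*) (H : Hypergraph α), H.vertexSet.ncard = n → H.IsUniform 3 → H.IsLinear →
          (n : ℝ) * Real.exp (C * Real.sqrt (Real.log n * Real.log (Real.log n))) ≤
            (H.edgeSet.ncard : ℝ) →
          H.ContainsRegular 2) ∧
      (∀ n : ℕ, 3 ≤ n →
        (Hypergraph.maxEdges n : ℝ) ≤
          (n : ℝ) * Real.exp (C * Real.sqrt (Real.log n * Real.log (Real.log n))))) ∧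
    (∃ ε : ℕ → ℝ, Tendsto ε atTop (𝓝 0) ∧
      ∀ n : ℕ, 3 ≤ n → (Hypergraph.maxEdges n : ℝ) = (n : ℝ) ^ (1 + ε n)) := by
  refine ⟨⟨100, by norm_num, fun n hn α H hc hu hlin hE =>
    Hypergraph.containsRegular_two_of_exp_le hu hlin hn hc hE,
    fun n hn => Hypergraph.maxEdges_le_exp hn⟩, _, Hypergraph.tendsto_log_maxEdges,
    fun n hn => ?_⟩
  obtain ⟨hx, -⟩ := Hypergraph.log_log_bounds hn
  have hn0 : (0 : ℝ) < n := by
    have : 0 < n := by omega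
    exact_mod_cast this
  have hm0 : (0 : ℝ) < Hypergraph.maxEdges n := by
    have := Hypergraph.div_three_le_maxEdges n
    have : 0 < Hypergraph.maxEdges n := by omega
    exact_mod_cast this
  -- With ε n = log f(n) / log n - 1 the identity is exact, because f(n) > 0 and log n ≠ 0.
  rw [add_sub_cancel, Real.rpow_def_of_pos hn0, mul_div_cancel₀ _ (by linarith : Real.log n ≠ 0),
    Real.exp_log hm0]
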